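/- Let $\mathbb{F}$ be any field and let $\mathbb{P}^2$ be the projective plane over $\mathbb{F}$. Let $X\subseteq\mathbb{P}^2$ be a smooth plane curve of degree $c$, let $d$ be an integer with $0<d<c$, let $E\subseteq X$ be a zero-dimensional (possibly empty) closed subscheme, and let $B\subseteq X(\mathbb{F})$ be a finite set of rational points with $B\cap E_{red}=\emptyset$. Let $C\subseteq\mathbb{F}^B$ be the code obtained by evaluating $H^0(X,\mathcal{O}_X(d)(-E))$ at the points of $B$, with respect to arbitrarily fixed homogeneous coordinates of these points, and let $C^\perp\subseteq\mathbb{F}^B$ be its dual code, i.e. the set of all $v$ with $\sum_{P\in B}v_Pc_P=0$ for all $c\in C$. For a finite set $S\subseteq B$ let $\mathcal{I}_{E\cup S}$ be the ideal sheaf in $\mathcal{O}_{\mathbb{P}^2}$ of the union of $E$ and the reduced scheme $S$, and write $h^1=\dim_{\mathbb{F}}H^1$. Let $z\in\mathbb{N}\cup\{\infty\}$ be the minimal cardinality of a subset $S\subseteq B$ such that $h^1(\mathbb{P}^2,\mathcal{I}_{E\cup S}(d))>h^1(\mathbb{P}^2,\mathcal{I}_E(d))$ ($z=\infty$ if there is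 no such $S$). Then: 1. The minimum distance of $C^\perp$ is $z$ (the minimum distance of the zero code being $\infty$). 2. A codeword of $C^\perp$ has weight $z$ if and only if its support is a subset $S\subseteq B$ such that (a) $\sharp S=z$; (b) $h^1(\mathbb{P}^2,\mathcal{I}_{E\cup S}(d))>h^1(\mathbb{P}^2,\mathcal{I}_E(d))$; (c) $h^1(\mathbb{P}^2,\mathcal{I}_{E\cup S}(d))>h^1(\mathbb{P}^2,\mathcal{I}_{E\cup S'}(d))$ for every $S'\subsetneq S$. Moreover, a subset $S\subseteq B$ is the support of a codeword of $C^\perp$ of weight $z$ if and only if it satisfies (a), (b) and (c). -/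

import Mathlib

namespace PlaneCode

noncomputable section

open MvPolynomial

/-- The homogeneous coordinate ring `F[x₀, x₁, x₂]` of the projective plane over `F`. -/
abbrev CoordRing (F : Type*) [Field F] : Type _ := MvPolynomial (Fin 3) F

/-- The field `F(x₀, x₁, x₂)`. All sections of twists of ideal sheaves over the charts below are
elements of this field, and restriction maps are inclusions. -/
abbrev FracField (F : Type*) [Field F] : Type _ := FractionRing (CoordRing F)

/-- The rational points of the projective plane over `F`. -/
abbrev Point (F : Type*) [Field F] : Type _ := Projectivization F (Fin 3 → F)

attribute [local instance] MvPolynomial.gradedAlgebra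

variable {F : Type*} [Field F]

/-! ### Closed subschemes of the plane -/

/-- A closed subscheme of the projective plane over `F`, given by its saturated homogeneous
ideal. The empty scheme corresponds to the unit ideal. -/
structure Subscheme (F : Type*) [Field F] where
  ideal : Ideal (CoordRing F)
  homogeneous : ideal.IsHomogeneous (homogeneousSubmodule (Fin 3) F)
  saturated : ∀ g : CoordRing F, (∀ i, ∃ n : ℕ, X i ^ n * g ∈ ideal) → g ∈ ideal

/-- The underlying set of a closed subscheme: the relevant homogeneous primes containing its
ideal. -/
def Subscheme.support (Z : Subscheme F) :
    Set (ProjectiveSpectrum (homogeneousSubmodule (Fin 3) F)) :=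
  ProjectiveSpectrum.zeroLocus _ (Z.ideal : Set (CoordRing F))

/-- `Z` is a zero-dimensional scheme (the empty scheme is allowed). -/
def Subscheme.IsZeroDimensional (Z : Subscheme F) : Prop :=
  topologicalKrullDim Z.support ≤ 0

/-- The scheme-theoretic union: the intersection of the ideals. -/
def Subscheme.union (Z W : Subscheme F) : Subscheme F where
  ideal := Z.ideal ⊓ W.ideal
  homogeneous := Z.homogeneous.inf W.homogeneous
  saturated g hg :=
    ⟨Z.saturated g fun i => (hg i).imp fun _ h => h.1,
      W.saturated g fun i => (hg i).imp fun _ h => h.2⟩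

/-- The homogeneous ideal of the point with homogeneous coordinates `p`: the polynomials that
vanish identically on the line `t ↦ t • p`, that is, all of whose homogeneous components vanish
at `p`. -/
def pointIdeal (p : Fin 3 → F) : Ideal (CoordRing F) :=
  RingHom.ker (aeval (fun i => Polynomial.C (p i) * Polynomial.X) :
    CoordRing F →ₐ[F] Polynomial F)

theorem aeval_line_of_isHomogeneous (p : Fin 3 → F) {g : CoordRing F} {n : ℕ}
    (hg : g.IsHomogeneous n) :
    aeval (fun i => Polynomial.C (p i) * Polynomial.X) g
      = Polynomial.C (eval p g) * Polynomial.X ^ n := by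
  rw [aeval_def, eval₂_eq', eval_eq', map_sum, Finset.sum_mul]
  refine Finset.sum_congr rfl fun m hm => ?_
  have h : ∑ i, m i = n := by
    have := hg (mem_support_iff.mp hm)
    rw [Finsupp.weight_apply, Finsupp.sum_fintype _ _ (by simp)] at this
    simpa using this
  rw [← h, ← Finset.prod_pow_eq_pow_sum]
  simp only [mul_pow, Finset.prod_mul_distrib, map_mul, map_prod, map_pow]
  simp [Polynomial.algebraMap_eq, mul_assoc]

theorem mem_pointIdeal_iff (p : Fin 3 → F) (g : CoordRing F) :
    g ∈ pointIdeal p ↔ ∀ n, eval p (homogeneousComponent n g) = 0 := by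
  have key : ∀ n, (aeval (fun i => Polynomial.C (p i) * Polynomial.X) g).coeff n
      = eval p (homogeneousComponent n g) := by
    intro n
    conv_lhs => rw [← sum_homogeneousComponent g]
    rw [map_sum, Polynomial.finsetSum_coeff]
    simp only [aeval_line_of_isHomogeneous p (homogeneousComponent_isHomogeneous _ g),
      Polynomial.coeff_C_mul_X_pow]
    rw [Finset.sum_ite_eq]
    split_ifs with h
    · rfl
    · rw [homogeneousComponent_eq_zero _ _ (by simpa using h), map_zero]
  rw [pointIdeal, RingHom.mem_ker]
  simp only [← key]
  exact ⟨fun h n => by simpa using congrArg (fun q => Polynomial.coeff q n) h,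
    fun h => Polynomial.ext (by simpa using h)⟩

theorem pointIdeal_isHomogeneous (p : Fin 3 → F) :
    (pointIdeal p).IsHomogeneous (homogeneousSubmodule (Fin 3) F) := by
  intro n g hg
  rw [mem_pointIdeal_iff] at hg
  have h : (DirectSum.decompose (homogeneousSubmodule (Fin 3) F) g n : CoordRing F)
      = homogeneousComponent n g := MvPolynomial.decomposition.decompose'_apply g n
  rw [h, mem_pointIdeal_iff]
  intro m
  rw [homogeneousComponent_of_mem (homogeneousComponent_isHomogeneous n g)]
  split_ifs
  · exact hg n
  · exact map_zero _

/-- A finite set of rational points, with its reduced scheme structure. -/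
def Subscheme.ofPoints (S : Finset (Point F)) : Subscheme F where
  ideal := ⨅ P ∈ S, pointIdeal P.rep
  homogeneous := Ideal.IsHomogeneous.iInf₂ fun P _ => pointIdeal_isHomogeneous (Projectivization.rep P)
  saturated g hg := by
    simp only [Submodule.mem_iInf] at hg ⊢
    intro P hP
    obtain ⟨i, hi⟩ := Function.ne_iff.mp P.rep_nonzero
    obtain ⟨n, hn⟩ := hg i
    have h := hn P hP
    rw [pointIdeal, RingHom.mem_ker, map_mul, map_pow, mul_eq_zero] at h
    refine h.resolve_left (pow_ne_zero _ ?_)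
    simpa using hi

/-! ### Sections over the standard charts and Čech cohomology -/

/-- For a homogeneous ideal `I`, the sections of the sheaf `Ĩ(d)` over the open set
where the coordinates `xᵢ`, `i ∈ T`, do not vanish: the fractions `a / (∏ i ∈ T, xᵢ) ^ n` of
degree `d` with `a ∈ I`. -/
def chartSections (I : Ideal (CoordRing F)) (d : ℕ) (T : Finset (Fin 3)) :
    Submodule F (FracField F) where
  carrier := {y | ∃ (n : ℕ) (a : CoordRing F), a ∈ I ∧ a.IsHomogeneous (d + n * T.card) ∧
    y = algebraMap (CoordRing F) (FracField F) a /
      algebraMap (CoordRing F) (FracField F) (∏ i ∈ T, X i) ^ n}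
  zero_mem' := ⟨0, 0, I.zero_mem, isHomogeneous_zero _ _ _, by simp⟩
  add_mem' := by
    rintro _ _ ⟨n, a, ha, hda, rfl⟩ ⟨m, b, hb, hdb, rfl⟩
    have hT : (∏ i ∈ T, X i : CoordRing F).IsHomogeneous T.card := by
      simpa using IsHomogeneous.prod T (fun i => (X i : CoordRing F)) (fun _ => 1)
        fun i _ => isHomogeneous_X F i
    have h0 : algebraMap (CoordRing F) (FracField F) (∏ i ∈ T, X i) ≠ 0 := by
      simp [Finset.prod_eq_zero_iff]
    refine ⟨n + m, a * (∏ i ∈ T, X i) ^ m + b * (∏ i ∈ T, X i) ^ n,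
      I.add_mem (I.mul_mem_right _ ha) (I.mul_mem_right _ hb), ?_, ?_⟩
    · refine IsHomogeneous.add ?_ ?_
      · convert hda.mul (hT.pow m) using 1; ring
      · convert hdb.mul (hT.pow n) using 1; ring
    · simp only [map_add, map_mul, map_pow]
      field_simp
      ring
  smul_mem' := by
    rintro r _ ⟨n, a, ha, hda, rfl⟩
    refine ⟨n, C r * a, I.mul_mem_left _ ha, ?_, ?_⟩
    · simpa using (isHomogeneous_C (Fin 3) r).mul hda
    · rw [Algebra.smul_def, map_mul, mul_div_assoc]
      rfl

/-- Restriction to a smaller chart. -/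
theorem chartSections_mono (I : Ideal (CoordRing F)) (d : ℕ) {T T' : Finset (Fin 3)}
    (h : T ⊆ T') : chartSections I d T ≤ chartSections I d T' := by
  rintro _ ⟨n, a, ha, hda, rfl⟩
  have hT : (∏ i ∈ T' \ T, X i : CoordRing F).IsHomogeneous (T' \ T).card := by
    simpa using IsHomogeneous.prod (T' \ T) (fun i => (X i : CoordRing F)) (fun _ => 1)
      fun i _ => isHomogeneous_X F i
  have h0 : ∀ U : Finset (Fin 3),
      algebraMap (CoordRing F) (FracField F) (∏ i ∈ U, X i) ≠ 0 := by
    simp [Finset.prod_eq_zero_iff]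
  refine ⟨n, a * (∏ i ∈ T' \ T, X i) ^ n, I.mul_mem_right _ ha, ?_, ?_⟩
  · convert hda.mul (hT.pow n) using 1
    rw [← Finset.card_sdiff_add_card_eq_card h]; ring
  · rw [← Finset.prod_sdiff h, map_mul, map_mul, map_pow]
    have h1 := h0 T
    have h2 := h0 (T' \ T)
    rw [mul_pow]
    field_simp

/-- Čech 1-cocycles of `Ĩ(d)` for the cover of the plane by the three charts `xᵢ ≠ 0`. -/
def cechCocycles (I : Ideal (CoordRing F)) (d : ℕ) :
    Submodule F (Fin 3 → Fin 3 → FracField F) where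
  carrier := {s | (∀ i j, s i j ∈ chartSections I d {i, j}) ∧
    ∀ i j k, s j k - s i k + s i j = 0}
  zero_mem' := ⟨fun _ _ => Submodule.zero_mem _, by simp⟩
  add_mem' := by
    rintro s t ⟨hs, hs'⟩ ⟨ht, ht'⟩
    refine ⟨fun i j => Submodule.add_mem _ (hs i j) (ht i j), fun i j k => ?_⟩
    have h1 := hs' i j k
    have h2 := ht' i j k
    simp only [Pi.add_apply]
    linear_combination h1 + h2
  smul_mem' := by
    rintro r s ⟨hs, hs'⟩
    refine ⟨fun i j => Submodule.smul_mem _ r (hs i j), fun i j k => ?_⟩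
    simp only [Pi.smul_apply, ← smul_sub, ← smul_add, hs' i j k, smul_zero]

/-- Čech 1-coboundaries of `Ĩ(d)`. -/
def cechCoboundaries (I : Ideal (CoordRing F)) (d : ℕ) :
    Submodule F (Fin 3 → Fin 3 → FracField F) where
  carrier := {s | ∃ t : Fin 3 → FracField F, (∀ i, t i ∈ chartSections I d {i}) ∧
    ∀ i j, s i j = t j - t i}
  zero_mem' := ⟨0, fun _ => Submodule.zero_mem _, by simp⟩
  add_mem' := by
    rintro s s' ⟨t, ht, hs⟩ ⟨t', ht', hs'⟩
    refine ⟨t + t', fun i => Submodule.add_mem _ (ht i) (ht' i), fun i j => ?_⟩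
    simp only [Pi.add_apply, hs, hs']
    ring
  smul_mem' := by
    rintro r s ⟨t, ht, hs⟩
    refine ⟨r • t, fun i => Submodule.smul_mem _ r (ht i), fun i j => ?_⟩
    simp only [Pi.smul_apply, hs, smul_sub]

/-- The cohomology group `H¹(ℙ², I_Z(d))` of the twisted ideal sheaf of `Z`, computed by the
Čech complex of the standard affine cover. -/
abbrev H1 (Z : Subscheme F) (d : ℕ) : Type _ :=
  cechCocycles Z.ideal d ⧸
    (cechCoboundaries Z.ideal d).comap (cechCocycles Z.ideal d).subtype

/-- `h¹(ℙ², I_Z(d))`. -/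
def h1 (Z : Subscheme F) (d : ℕ) : ℕ := Module.finrank F (H1 Z d)

/-! ### The curve, the line bundle and the code -/

/-- The homogeneous form `f` of degree `c` defines a smooth plane curve: it has no singular
point over an algebraic closure. -/
def IsSmoothCurve (f : CoordRing F) (c : ℕ) : Prop :=
  f.IsHomogeneous c ∧ ∀ p : Fin 3 → AlgebraicClosure F, p ≠ 0 → aeval p f = 0 →
    ∃ i, aeval p (pderiv i f) ≠ 0

/-- For the curve `X` with equation `f` and a closed subscheme `E` of `X`, the space
`H⁰(X, 𝒪_X(d)(-E))` of global sections of the sheaf `(I_E / I_X)(d)`: a section over each chart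
`xᵢ ≠ 0`, that is, an element of `I_E(d) / I_X(d)` there, such that these agree on overlaps. -/
def curveSections (f : CoordRing F) (E : Subscheme F) (d : ℕ) :
    Submodule F (∀ i : Fin 3, FracField F ⧸ chartSections (Ideal.span {f}) d {i}) where
  carrier := {s | (∀ i, s i ∈ (chartSections E.ideal d {i}).map
      (chartSections (Ideal.span {f}) d {i}).mkQ) ∧
    ∀ i j,
      Submodule.factor (chartSections_mono (Ideal.span {f}) d (T := {i}) (T' := {i, j})
        (by simp)) (s i) =
      Submodule.factor (chartSections_mono (Ideal.span {f}) d (T := {j}) (T' := {i, j})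
        (by simp)) (s j)}
  zero_mem' := ⟨fun _ => Submodule.zero_mem _, by simp⟩
  add_mem' := by
    rintro s t ⟨hs, hs'⟩ ⟨ht, ht'⟩
    refine ⟨fun i => Submodule.add_mem _ (hs i) (ht i), fun i j => ?_⟩
    simp only [Pi.add_apply, map_add, hs' i j, ht' i j]
  smul_mem' := by
    rintro r s ⟨hs, hs'⟩
    refine ⟨fun i => Submodule.smul_mem _ r (hs i), fun i j => ?_⟩
    simp only [Pi.smul_apply, map_smul, hs' i j]

/-- The local section `s` over the chart `xᵢ ≠ 0` has value `v` at the point of the curve with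
homogeneous coordinates `p` (where `p i ≠ 0`): `s` is represented by a fraction `a / xᵢ ^ n` of
degree `d` whose value at `p` is `v`. -/
def HasValueAt (f : CoordRing F) (d : ℕ) (i : Fin 3)
    (s : FracField F ⧸ chartSections (Ideal.span {f}) d {i}) (p : Fin 3 → F) (v : F) : Prop :=
  ∃ (n : ℕ) (a : CoordRing F), a.IsHomogeneous (d + n) ∧
    s = Submodule.Quotient.mk (algebraMap (CoordRing F) (FracField F) a /
      algebraMap (CoordRing F) (FracField F) (X i) ^ n) ∧
    v = eval p a / p i ^ n

/-- The code obtained by evaluating `H⁰(X, 𝒪_X(d)(-E))` at a family of points of the curve `X`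
with equation `f`, given by homogeneous coordinates `p k`. -/
def evaluationCode {ι : Type*} (f : CoordRing F) (E : Subscheme F) (d : ℕ)
    (p : ι → Fin 3 → F) : Submodule F (ι → F) where
  carrier := {v | ∃ s ∈ curveSections f E d,
    ∀ k i, p k i ≠ 0 → HasValueAt f d i (s i) (p k) (v k)}
  zero_mem' := ⟨0, Submodule.zero_mem _, fun k i _ =>
    ⟨0, 0, isHomogeneous_zero _ _ _, by simp, by simp⟩⟩
  add_mem' := by
    rintro v w ⟨s, hs, hv⟩ ⟨t, ht, hw⟩
    refine ⟨s + t, Submodule.add_mem _ hs ht, fun k i hi => ?_⟩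
    obtain ⟨n, a, ha, hsa, hva⟩ := hv k i hi
    obtain ⟨m, b, hb, htb, hwb⟩ := hw k i hi
    have h0 : algebraMap (CoordRing F) (FracField F) (X i) ≠ 0 := by simp
    refine ⟨n + m, a * X i ^ m + b * X i ^ n, ?_, ?_, ?_⟩
    · refine IsHomogeneous.add ?_ ?_
      · convert ha.mul ((isHomogeneous_X F i).pow m) using 1; ring
      · convert hb.mul ((isHomogeneous_X F i).pow n) using 1; ring
    · rw [Pi.add_apply, hsa, htb, ← Submodule.Quotient.mk_add]
      congr 1
      simp only [map_add, map_mul, map_pow]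
      field_simp
      ring
    · rw [Pi.add_apply, hva, hwb]
      simp only [map_add, map_mul, map_pow, eval_X]
      field_simp
      ring
  smul_mem' := by
    rintro r v ⟨s, hs, hv⟩
    refine ⟨r • s, Submodule.smul_mem _ r hs, fun k i hi => ?_⟩
    obtain ⟨n, a, ha, hsa, hva⟩ := hv k i hi
    refine ⟨n, C r * a, ?_, ?_, ?_⟩
    · simpa using (isHomogeneous_C (Fin 3) r).mul ha
    · rw [Pi.smul_apply, hsa, ← Submodule.Quotient.mk_smul, Algebra.smul_def, map_mul,
        mul_div_assoc]
      rfl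
    · rw [Pi.smul_apply, hva]
      simp [mul_div_assoc]

/-! ### Linear codes -/

/-- The dual code. -/
def dualCode {ι : Type*} [Fintype ι] (C : Submodule F (ι → F)) : Submodule F (ι → F) where
  carrier := {v | ∀ c ∈ C, v ⬝ᵥ c = 0}
  zero_mem' := fun c _ => zero_dotProduct c
  add_mem' := fun {v w} hv hw c hc => by rw [add_dotProduct, hv c hc, hw c hc, add_zero]
  smul_mem' := fun r v hv c hc => by rw [smul_dotProduct, hv c hc, smul_zero]

open Classical in
/-- The Hamming weight. -/
def weight {ι : Type*} [Fintype ι] (v : ι → F) : ℕ := hammingNorm v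

open Classical in
/-- The minimum distance of a code, which is `∞` for the zero code. -/
def minDist {ι : Type*} [Fintype ι] (C : Submodule F (ι → F)) : ℕ∞ :=
  ⨅ (v ∈ C) (w ∈ C) (_ : v ≠ w), (hammingDist v w : ℕ∞)

/-- The word `v`, indexed by the points of `B`, has support exactly `S`. -/
def HasSupport {B : Finset (Point F)} (v : B → F) (S : Finset (Point F)) : Prop :=
  S ⊆ B ∧ ∀ P : B, v P ≠ 0 ↔ (P : Point F) ∈ S

end

end PlaneCode

open PlaneCode

namespace PlaneCode

noncomputable section

open MvPolynomial

attribute [local instance] MvPolynomial.gradedAlgebra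

variable {F : Type*} [Field F]

local notation "φ" => algebraMap (CoordRing F) (FracField F)

/-! The code consists of the value vectors on `B` of the forms of degree `d` in the ideal of `E`.
Indeed H¹(ℙ², I_X(d)) = 0 because the ideal of `X` is principal (`cechCocycles_span_le`), so every
section of (I_E/I_X)(d) lifts to such a form (`mem_evaluationCode_iff`). A dual word supported in
`S` is therefore a linear relation among the evaluations at the points of `S` on H⁰(I_E(d)).

Since `S` misses `E`, there is an exact sequence 0 → I_{E∪S}(d) → I_E(d) → 𝒪_S → 0, and H¹(𝒪_S) = 0.
Hence H¹(I_{E∪S}(d)) → H¹(I_E(d)) is onto, and it is injective exactly when evaluation H⁰(I_E(d)) →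
F^S is onto. So h¹ jumps if and only if a nonzero dual word is supported in `S`
(`h1_lt_h1_union_iff`), and `z` is the minimum distance. The same sequence for `S'` ⊂ `S` shows that
h¹ drops on every proper subset of the support of a dual word (`h1_union_lt_h1_union`), which is
condition (c).

The sequence is worked out on Čech cochains: sections of the smaller ideal are those with value 0 at
the points, and sections with prescribed values exist on each chart
(`SeparatesPoints.exists_section`). Since `finrank` is 0 in infinite dimension, comparing h¹ also
needs H¹ to be finite-dimensional; this is where `E` being zero-dimensional enters. -/

/-! ### Chart sections, and Čech vanishing for principal ideals -/

theorem frac_injective : Function.Injective (algebraMap (CoordRing F) (FracField F)) :=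
  IsFractionRing.injective _ _

theorem frac_X_ne_zero (i : Fin 3) : algebraMap (CoordRing F) (FracField F) (X i) ≠ 0 := by
  simp

theorem prod_X_isHomogeneous (T : Finset (Fin 3)) :
    (∏ i ∈ T, X i : CoordRing F).IsHomogeneous T.card := by
  simpa using IsHomogeneous.prod T (fun i => (X i : CoordRing F)) (fun _ => 1)
    fun i _ => isHomogeneous_X F i

theorem frac_prod_X_ne_zero (T : Finset (Fin 3)) :
    algebraMap (CoordRing F) (FracField F) (∏ i ∈ T, X i) ≠ 0 := by
  simp [Finset.prod_eq_zero_iff]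

theorem homogeneousComponent_mul_left {a : CoordRing F} {m : ℕ} (ha : a.IsHomogeneous m)
    (b : CoordRing F) (n : ℕ) :
    homogeneousComponent (m + n) (a * b) = a * homogeneousComponent n b := by
  have h : ∀ (g : CoordRing F) (n : ℕ),
      (DirectSum.decompose (homogeneousSubmodule (Fin 3) F) g n : CoordRing F)
        = homogeneousComponent n g := fun g n => MvPolynomial.decomposition.decompose'_apply g n
  rw [← h, ← h]
  exact DirectSum.coe_decompose_mul_add_of_left_mem _ ha

theorem span_singleton_isHomogeneous {g : CoordRing F} {e : ℕ} (hg : g.IsHomogeneous e) :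
    (Ideal.span {g}).IsHomogeneous (homogeneousSubmodule (Fin 3) F) :=
  Ideal.homogeneous_span _ _ (by rintro x rfl; exact ⟨e, hg⟩)

theorem mem_chartSections_of_mul_eq {I : Ideal (CoordRing F)} {d n : ℕ} {T : Finset (Fin 3)}
    {y : FracField F} {a : CoordRing F} (ha : a ∈ I) (hd : a.IsHomogeneous (d + n * T.card))
    (h : y * φ (∏ i ∈ T, X i) ^ n = φ a) : y ∈ chartSections I d T :=
  ⟨n, a, ha, hd, by
    rw [← h, eq_div_iff (pow_ne_zero n (frac_prod_X_ne_zero T))]⟩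

theorem exists_numerator {I : Ideal (CoordRing F)} {d : ℕ} {T : Finset (Fin 3)}
    {y : FracField F} (hy : y ∈ chartSections I d T) :
    ∃ N, ∀ n ≥ N, ∃ a ∈ I, a.IsHomogeneous (d + n * T.card) ∧
      y * φ (∏ i ∈ T, X i) ^ n = φ a := by
  obtain ⟨N, a, ha, hd, rfl⟩ := hy
  refine ⟨N, fun n hn => ?_⟩
  obtain ⟨m, rfl⟩ := Nat.exists_eq_add_of_le hn
  refine ⟨a * (∏ i ∈ T, X i) ^ m, I.mul_mem_right _ ha, ?_, ?_⟩
  · convert hd.mul ((prod_X_isHomogeneous T).pow m) using 1; ring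
  · have := frac_prod_X_ne_zero (F := F) T
    rw [map_mul, map_pow, pow_add]
    field_simp

theorem chartSections_mono_ideal {I J : Ideal (CoordRing F)} (h : I ≤ J) (d : ℕ)
    (T : Finset (Fin 3)) : chartSections I d T ≤ chartSections J d T := by
  rintro _ ⟨n, a, ha, hd, rfl⟩
  exact ⟨n, a, h ha, hd, rfl⟩

theorem frac_mem_chartSections {I : Ideal (CoordRing F)} {d : ℕ} {g : CoordRing F}
    (hg : g ∈ I) (hd : g.IsHomogeneous d) (T : Finset (Fin 3)) : φ g ∈ chartSections I d T :=
  ⟨0, g, hg, by simpa using hd, by simp⟩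

theorem not_X_dvd_X_pow {i j : Fin 3} (h : i ≠ j) (n : ℕ) :
    ¬ (X i : CoordRing F) ∣ X j ^ n := fun h' =>
  h (X_dvd_X.mp (X_prime.dvd_of_dvd_pow h'))

/-- Membership in the monomial ideal (X i ^ n, X j ^ n) is tested monomial by monomial, and a factor
X k ^ n affects neither exponent. -/
theorem exists_eq_of_X_pow_mul_eq (i j k : Fin 3) (hik : i ≠ k) (hjk : j ≠ k) (n : ℕ)
    {a b c : CoordRing F} (h : X k ^ n * a = X i ^ n * b + X j ^ n * c) :
    ∃ u v, a = X i ^ n * u + X j ^ n * v := by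
  have key : ∀ x : CoordRing F,
      x ∈ Ideal.span ((fun s => monomial s (1 : F)) ''
        {Finsupp.single i n, Finsupp.single j n}) ↔ ∃ u v, x = X i ^ n * u + X j ^ n * v := by
    intro x
    rw [Set.image_pair, Ideal.mem_span_pair]
    simp only [← X_pow_eq_monomial]
    constructor
    · rintro ⟨u, v, rfl⟩; exact ⟨u, v, by ring⟩
    · rintro ⟨u, v, rfl⟩; exact ⟨u, v, by ring⟩
  rw [← key]
  have h1 := (key _).mpr ⟨b, c, h⟩
  rw [mem_ideal_span_monomial_image] at h1 ⊢
  intro m hm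
  have hm' : Finsupp.single k n + m ∈ (X k ^ n * a).support := by
    rw [mem_support_iff, X_pow_eq_monomial, coeff_monomial_mul, one_mul]
    exact mem_support_iff.mp hm
  obtain ⟨s, hs, hsm⟩ := h1 _ hm'
  refine ⟨s, hs, ?_⟩
  rcases hs with rfl | rfl
  · rw [Finsupp.single_le_iff] at hsm ⊢
    simpa [hik.symm] using hsm
  · rw [Finsupp.single_le_iff] at hsm ⊢
    simpa [hjk.symm] using hsm

/-- Comparing the two expressions of `y`, the coprimality of X i and X j removes the power of X i
from the denominator. -/
theorem mem_chartSections_inter {g : CoordRing F} {d : ℕ}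
    (hg0 : g ≠ 0) {i j k : Fin 3} (hij : i ≠ j) (hik : i ≠ k) (hjk : j ≠ k) {y : FracField F}
    (h1 : y ∈ chartSections (Ideal.span {g}) d {i, k})
    (h2 : y ∈ chartSections (Ideal.span {g}) d {j, k}) :
    y ∈ chartSections (Ideal.span {g}) d {k} := by
  obtain ⟨N, hN⟩ := exists_numerator h1
  obtain ⟨M, hM⟩ := exists_numerator h2
  obtain ⟨a, ha, had, hya⟩ := hN (max N M) (le_max_left _ _)
  obtain ⟨b, hb, hbd, hyb⟩ := hM (max N M) (le_max_right _ _)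
  generalize max N M = n at *
  obtain ⟨a', rfl⟩ := Ideal.mem_span_singleton.mp ha
  obtain ⟨b', rfl⟩ := Ideal.mem_span_singleton.mp hb
  rw [Finset.prod_pair hik, map_mul] at hya
  rw [Finset.prod_pair hjk, map_mul] at hyb
  rw [Finset.card_pair hik] at had
  have e1 : g * (a' * X j ^ n) = g * (b' * X i ^ n) := by
    apply frac_injective
    have e2 : φ (g * a') * φ (X j) ^ n = φ (g * b') * φ (X i) ^ n := by
      rw [← hya, ← hyb]; ring
    simpa only [map_mul, map_pow, mul_assoc] using e2
  have e3 := mul_left_cancel₀ hg0 e1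
  obtain ⟨h, rfl⟩ := X_prime.pow_dvd_of_dvd_mul_right n (not_X_dvd_X_pow hij n)
    (e3 ▸ Dvd.intro_left _ rfl : X i ^ n ∣ a' * X j ^ n)
  -- The factor `h` is not known to be homogeneous; the degree of `g * h` is recovered by cancelling
  -- X i ^ n in its homogeneous component.
  have hh : X i ^ n * (g * h) = X i ^ n * homogeneousComponent (d + n) (g * h) := by
    have := homogeneousComponent_mul_left ((isHomogeneous_X F i).pow n) (g * h) (d + n)
    rw [← this, homogeneousComponent_eq_self]
    · convert had using 1 <;> ring
  have hh' := mul_left_cancel₀ (pow_ne_zero n (X_ne_zero i)) hh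
  refine mem_chartSections_of_mul_eq (n := n) (a := g * h)
    (Ideal.mul_mem_right _ _ (Ideal.mem_span_singleton_self g)) ?_ ?_
  · rw [hh']
    simpa using homogeneousComponent_isHomogeneous (d + n) (g * h)
  · have := pow_ne_zero n (frac_X_ne_zero (F := F) i)
    rw [Finset.prod_singleton]
    apply mul_left_cancel₀ this
    simp only [map_mul, map_pow] at hya ⊢
    linear_combination hya

/-- This is H¹(ℙ², 𝒪(m)) = 0. The cocycle relation puts the numerator of `s 0 1` in (X 0 ^ n, X 1 ^
n), which splits `s 0 1` into a section on chart 1 and one on chart 0. After this correction the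
remaining component extends to chart 2 by `mem_chartSections_inter`. -/
theorem cechCocycles_span_le {g : CoordRing F} {e : ℕ} (d : ℕ) (hg : g.IsHomogeneous e)
    (hg0 : g ≠ 0) :
    cechCocycles (Ideal.span {g}) d ≤ cechCoboundaries (Ideal.span {g}) d := by
  rintro s ⟨hs, hc⟩
  have h0 := frac_X_ne_zero (F := F)
  obtain ⟨N₁, hN₁⟩ := exists_numerator (hs 0 1)
  obtain ⟨N₂, hN₂⟩ := exists_numerator (hs 1 2)
  obtain ⟨N₃, hN₃⟩ := exists_numerator (hs 0 2)
  obtain ⟨n, hn₁, hn₂, hn₃⟩ : ∃ n, N₁ ≤ n ∧ N₂ ≤ n ∧ N₃ ≤ n :=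
    ⟨N₁ + N₂ + N₃, by omega, by omega, by omega⟩
  obtain ⟨a, ha, had, hsa⟩ := hN₁ n hn₁
  obtain ⟨b, hb, hbd, hsb⟩ := hN₂ n hn₂
  obtain ⟨c, hc', hcd, hsc⟩ := hN₃ n hn₃
  obtain ⟨a, rfl⟩ := Ideal.mem_span_singleton.mp ha
  obtain ⟨b, rfl⟩ := Ideal.mem_span_singleton.mp hb
  obtain ⟨c, rfl⟩ := Ideal.mem_span_singleton.mp hc'
  rw [Finset.prod_pair (by decide)] at hsa hsb hsc
  rw [Finset.card_pair (by decide)] at had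
  simp only [map_mul] at hsa hsb hsc
  have e1 : g * (X 2 ^ n * a) = g * (X 0 ^ n * (-b) + X 1 ^ n * c) := by
    apply frac_injective
    simp only [map_mul, map_add, map_neg, map_pow]
    linear_combination -φ (X 0) ^ n * hsb + φ (X 1) ^ n * hsc - φ (X 2) ^ n * hsa
      + hc 0 1 2 * (φ (X 0) * φ (X 1) * φ (X 2)) ^ n
  obtain ⟨u, v, rfl⟩ := exists_eq_of_X_pow_mul_eq 0 1 2 (by decide) (by decide) n
    (mul_left_cancel₀ hg0 e1)
  -- The cofactors `u`, `v` need not be homogeneous; only the components of `g * u`, `g * v` in the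
  -- right degree are kept.
  set U := homogeneousComponent (d + n) (g * u) with hU
  set V := homogeneousComponent (d + n) (g * v) with hV
  have hgI := span_singleton_isHomogeneous hg
  have hUI : U ∈ Ideal.span {g} := homogeneousComponent_mem_of_mem hgI
    (Ideal.mul_mem_right _ _ (Ideal.mem_span_singleton_self g)) _
  have hVI : V ∈ Ideal.span {g} := homogeneousComponent_mem_of_mem hgI
    (Ideal.mul_mem_right _ _ (Ideal.mem_span_singleton_self g)) _
  have hUd : U.IsHomogeneous (d + n) := homogeneousComponent_isHomogeneous _ _
  have hVd : V.IsHomogeneous (d + n) := homogeneousComponent_isHomogeneous _ _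
  have e2 : g * (X 0 ^ n * u + X 1 ^ n * v) = X 0 ^ n * U + X 1 ^ n * V := by
    have h1 := homogeneousComponent_mul_left ((isHomogeneous_X F 0).pow n) (g * u) (d + n)
    have h2 := homogeneousComponent_mul_left ((isHomogeneous_X F 1).pow n) (g * v) (d + n)
    rw [hU, hV, ← h1, ← h2, ← map_add, homogeneousComponent_eq_self]
    · ring
    · convert had using 1 <;> ring
  have e3 : s 0 1 = φ U / φ (X 1) ^ n + φ V / φ (X 0) ^ n := by
    have e4 := congrArg φ e2
    simp only [map_mul, map_add, map_pow] at e4 hsa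
    have h00 := h0 0
    have h01 := h0 1
    field_simp
    linear_combination e4 + hsa
  have hUs : φ U / φ (X 1) ^ n ∈ chartSections (Ideal.span {g}) d {1} :=
    ⟨n, U, hUI, by simpa using hUd, by simp⟩
  have hVs : φ V / φ (X 0) ^ n ∈ chartSections (Ideal.span {g}) d {0} :=
    ⟨n, V, hVI, by simpa using hVd, by simp⟩
  refine ⟨fun j => s 0 j - φ V / φ (X 0) ^ n, fun j => ?_, fun i j => ?_⟩
  · match j with
    | 0 =>
      have : s 0 0 = 0 := by simpa using hc 0 0 0
      simp only [this, zero_sub]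
      exact Submodule.neg_mem _ hVs
    | 1 => simpa only [e3, add_sub_cancel_right] using hUs
    | 2 =>
      refine mem_chartSections_inter hg0 (i := 0) (j := 1) (by decide) (by decide)
        (by decide) ?_ ?_
      · exact Submodule.sub_mem _ (hs 0 2) (chartSections_mono _ _ (by simp) hVs)
      · have : s 0 2 - φ V / φ (X 0) ^ n = s 1 2 + φ U / φ (X 1) ^ n := by
          linear_combination e3 - hc 0 1 2
        simp only [this]
        exact Submodule.add_mem _ (hs 1 2) (chartSections_mono _ _ (by simp) hUs)
  · linear_combination hc 0 i j

/-- Regularity on charts 0 and 1 already makes `y` a polynomial; saturation then puts it in `I`. -/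
theorem exists_global_section {I : Ideal (CoordRing F)}
    (hI : ∀ g : CoordRing F, (∀ i, ∃ n : ℕ, X i ^ n * g ∈ I) → g ∈ I) {d : ℕ} {y : FracField F}
    (hy : ∀ i, y ∈ chartSections I d {i}) : ∃ g ∈ I, g.IsHomogeneous d ∧ y = φ g := by
  have h : ∀ i, ∃ N, ∀ n ≥ N, ∃ a ∈ I, a.IsHomogeneous (d + n) ∧ y * φ (X i) ^ n = φ a := by
    intro i
    simpa using exists_numerator (hy i)
  choose N hN using h
  choose a haI had hya using fun i => hN i (N i) le_rfl
  have e1 : a 0 * X 1 ^ N 1 = a 1 * X 0 ^ N 0 := by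
    apply frac_injective
    simp only [map_mul, map_pow, ← hya]
    ring
  obtain ⟨h, hh⟩ := X_prime.pow_dvd_of_dvd_mul_right (N 0)
    (not_X_dvd_X_pow (F := F) (i := 0) (j := 1) (by decide) (N 1))
    (e1 ▸ Dvd.intro_left _ rfl : X 0 ^ N 0 ∣ a 0 * X 1 ^ N 1)
  have hyh : y = φ h := by
    apply mul_right_cancel₀ (pow_ne_zero (N 0) (frac_X_ne_zero (F := F) 0))
    rw [hya 0, hh, map_mul, map_pow, mul_comm]
  refine ⟨h, hI h fun i => ⟨N i, ?_⟩, ?_, hyh⟩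
  · convert haI i using 1
    apply frac_injective
    rw [← hya i, hyh, map_mul, map_pow, mul_comm]
  · have := homogeneousComponent_mul_left ((isHomogeneous_X F 0).pow (N 0)) h d
    rw [← hh, homogeneousComponent_eq_self (by convert had 0 using 1; ring), hh] at this
    rw [mul_left_cancel₀ (pow_ne_zero _ (X_ne_zero 0)) this]
    exact homogeneousComponent_isHomogeneous _ _

/-! ### Values of fractions at rational points -/

/-- The fraction `y` is regular at the point with homogeneous coordinates `p`. -/
def IsRegularAt (p : Fin 3 → F) (y : FracField F) : Prop :=
  ∃ a b : CoordRing F, eval p b ≠ 0 ∧ y * φ b = φ a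

open Classical in
/-- The value at `p` of a fraction that is regular at `p` (and `0` for other fractions). -/
def pointValue (p : Fin 3 → F) (y : FracField F) : F :=
  if h : IsRegularAt p y then eval p h.choose / eval p h.choose_spec.choose else 0

theorem pointValue_eq {p : Fin 3 → F} {y : FracField F} {a b : CoordRing F}
    (hb : eval p b ≠ 0) (h : y * φ b = φ a) : pointValue p y = eval p a / eval p b := by
  have hr : IsRegularAt p y := ⟨a, b, hb, h⟩
  rw [pointValue, dif_pos hr]
  obtain ⟨hb', h'⟩ := hr.choose_spec.choose_spec
  generalize Exists.choose (Exists.choose_spec hr) = b' at *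
  generalize Exists.choose hr = a' at *
  rw [div_eq_div_iff hb' hb, ← map_mul, ← map_mul]
  congr 1
  apply frac_injective
  rw [map_mul, map_mul, ← h, ← h']
  ring

theorem pointValue_frac (p : Fin 3 → F) (g : CoordRing F) : pointValue p (φ g) = eval p g := by
  rw [pointValue_eq (a := g) (b := 1) (by simp) (by simp)]
  simp

theorem isRegularAt_frac (p : Fin 3 → F) (g : CoordRing F) : IsRegularAt p (φ g) :=
  ⟨g, 1, by simp, by simp⟩

theorem IsRegularAt.add_aux {p : Fin 3 → F} {x y : FracField F} (hx : IsRegularAt p x)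
    (hy : IsRegularAt p y) :
    IsRegularAt p (x + y) ∧ pointValue p (x + y) = pointValue p x + pointValue p y := by
  obtain ⟨a, b, hb, h⟩ := hx
  obtain ⟨a', b', hb', h'⟩ := hy
  have h1 : eval p (b * b') ≠ 0 := by simp [hb, hb']
  have h2 : (x + y) * φ (b * b') = φ (a * b' + a' * b) := by
    simp only [map_mul, map_add, ← h, ← h']; ring
  refine ⟨⟨_, _, h1, h2⟩, ?_⟩
  rw [pointValue_eq h1 h2, pointValue_eq hb h, pointValue_eq hb' h']
  simp only [map_mul, map_add]
  field_simp

theorem IsRegularAt.add {p : Fin 3 → F} {x y : FracField F} (hx : IsRegularAt p x)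
    (hy : IsRegularAt p y) : IsRegularAt p (x + y) := (hx.add_aux hy).1

theorem pointValue_add {p : Fin 3 → F} {x y : FracField F} (hx : IsRegularAt p x)
    (hy : IsRegularAt p y) : pointValue p (x + y) = pointValue p x + pointValue p y :=
  (hx.add_aux hy).2

theorem IsRegularAt.smul_aux {p : Fin 3 → F} {x : FracField F} (r : F) (hx : IsRegularAt p x) :
    IsRegularAt p (r • x) ∧ pointValue p (r • x) = r * pointValue p x := by
  obtain ⟨a, b, hb, h⟩ := hx
  have h2 : (r • x) * φ b = φ (C r * a) := by
    rw [map_mul, ← h, smul_mul_assoc, Algebra.smul_def]; rfl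
  refine ⟨⟨_, _, hb, h2⟩, ?_⟩
  rw [pointValue_eq hb h2, pointValue_eq hb h]
  simp [mul_div_assoc]

theorem IsRegularAt.smul {p : Fin 3 → F} {x : FracField F} (r : F) (hx : IsRegularAt p x) :
    IsRegularAt p (r • x) := (hx.smul_aux r).1

theorem pointValue_smul {p : Fin 3 → F} {x : FracField F} (r : F) (hx : IsRegularAt p x) :
    pointValue p (r • x) = r * pointValue p x := (hx.smul_aux r).2

theorem IsRegularAt.neg {p : Fin 3 → F} {x : FracField F} (hx : IsRegularAt p x) :
    IsRegularAt p (-x) := by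
  simpa using hx.smul (-1)

theorem pointValue_sub {p : Fin 3 → F} {x y : FracField F} (hx : IsRegularAt p x)
    (hy : IsRegularAt p y) : pointValue p (x - y) = pointValue p x - pointValue p y := by
  have h := pointValue_smul (-1) hy
  rw [neg_one_smul, neg_one_mul] at h
  rw [sub_eq_add_neg, pointValue_add hx hy.neg, h, sub_eq_add_neg]

theorem IsRegularAt.sum_aux {κ : Type*} {p : Fin 3 → F} {x : κ → FracField F} (s : Finset κ)
    (hx : ∀ k ∈ s, IsRegularAt p (x k)) :
    IsRegularAt p (∑ k ∈ s, x k) ∧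
      pointValue p (∑ k ∈ s, x k) = ∑ k ∈ s, pointValue p (x k) := by
  classical
  induction s using Finset.induction_on with
  | empty =>
    have h1 := isRegularAt_frac p 0
    have h2 := pointValue_frac p 0
    rw [map_zero] at h1 h2
    exact ⟨by simpa using h1, by simpa using h2⟩
  | insert k s hk ih =>
    obtain ⟨h1, h2⟩ := ih fun l hl => hx l (Finset.mem_insert_of_mem hl)
    have h3 := hx k (Finset.mem_insert_self k s)
    rw [Finset.sum_insert hk, Finset.sum_insert hk, pointValue_add h3 h1, h2]
    exact ⟨h3.add h1, rfl⟩

theorem eval_prod_X_pow_ne_zero {p : Fin 3 → F} {T : Finset (Fin 3)} (hp : ∀ i ∈ T, p i ≠ 0)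
    (n : ℕ) : eval p ((∏ i ∈ T, X i) ^ n) ≠ 0 := by
  rw [map_pow, map_prod]
  exact pow_ne_zero n (Finset.prod_ne_zero_iff.mpr fun i hi => by simpa using hp i hi)

theorem isRegularAt_of_mem {I : Ideal (CoordRing F)} {d : ℕ} {T : Finset (Fin 3)}
    {p : Fin 3 → F} (hp : ∀ i ∈ T, p i ≠ 0) {y : FracField F} (hy : y ∈ chartSections I d T) :
    IsRegularAt p y := by
  obtain ⟨N, hN⟩ := exists_numerator hy
  obtain ⟨a, -, -, h⟩ := hN N le_rfl
  exact ⟨a, _, eval_prod_X_pow_ne_zero hp N, by rw [map_pow, h]⟩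

theorem pointValue_eq_zero_of_mem {I : Ideal (CoordRing F)} {d : ℕ} {T : Finset (Fin 3)}
    {p : Fin 3 → F} (hp : ∀ i ∈ T, p i ≠ 0)
    (hI : ∀ n, ∀ a ∈ I, a.IsHomogeneous n → eval p a = 0) {y : FracField F}
    (hy : y ∈ chartSections I d T) : pointValue p y = 0 := by
  obtain ⟨N, hN⟩ := exists_numerator hy
  obtain ⟨a, ha, had, h⟩ := hN N le_rfl
  rw [pointValue_eq (a := a) (eval_prod_X_pow_ne_zero hp N) (by rw [map_pow, h]), hI _ a ha had, zero_div]

/-! ### The code as the values of forms -/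

/-- Chartwise lifts of a section differ on overlaps by a cocycle of I_X(d). It is a coboundary, so
the lifts can be corrected by sections of I_X(d), which vanish at the points, to glue to one form.
-/
theorem mem_evaluationCode_iff {κ : Type*} {f : CoordRing F} {c d : ℕ} (hfc : f.IsHomogeneous c)
    (hf0 : f ≠ 0) (E : Subscheme F) (hfE : Ideal.span {f} ≤ E.ideal) (p : κ → Fin 3 → F)
    (hp : ∀ k, p k ≠ 0) (hpf : ∀ k, eval (p k) f = 0) (v : κ → F) :
    v ∈ evaluationCode f E d p ↔
      ∃ g ∈ E.ideal, g.IsHomogeneous d ∧ ∀ k, v k = eval (p k) g := by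
  constructor
  · rintro ⟨s, ⟨hs, hs'⟩, hv⟩
    choose t ht hts using fun i => Submodule.mem_map.mp (hs i)
    have hcoc : (fun i j => t j - t i) ∈ cechCocycles (Ideal.span {f}) d := by
      refine ⟨fun i j => ?_, fun i j k => by ring⟩
      have h := hs' i j
      rw [← hts, ← hts, Submodule.factor_mk, Submodule.factor_mk] at h
      exact (Submodule.Quotient.eq _).mp h.symm
    obtain ⟨u, hu, htu⟩ := cechCocycles_span_le d hfc hf0 hcoc
    obtain ⟨g, hgE, hgd, hg⟩ := exists_global_section (d := d) (y := t 0 - u 0) E.saturated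
      (fun i => by
        have : t 0 - u 0 = t i - u i := by linear_combination - htu 0 i
        rw [this]
        exact Submodule.sub_mem _ (ht i) (chartSections_mono_ideal hfE d _ (hu i)))
    refine ⟨g, hgE, hgd, fun k => ?_⟩
    obtain ⟨i, hi⟩ := Function.ne_iff.mp (hp k)
    have hi' : ∀ j ∈ ({i} : Finset (Fin 3)), p k j ≠ 0 := by simpa using hi
    obtain ⟨n, a, had, hsa, hva⟩ := hv k i hi
    have hmem : φ a / φ (X i) ^ n - φ g ∈ chartSections (Ideal.span {f}) d {i} := by
      rw [← hts, Submodule.mkQ_apply, eq_comm, Submodule.Quotient.eq] at hsa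
      have : φ a / φ (X i) ^ n - φ g = (φ a / φ (X i) ^ n - t i) + u i := by
        linear_combination hg + htu 0 i
      rw [this]
      exact Submodule.add_mem _ hsa (hu i)
    have hb : eval (p k) (X i ^ n) ≠ 0 := by simpa using fun h => (hi h).elim
    have hab : φ a / φ (X i) ^ n * φ (X i ^ n) = φ a := by
      rw [map_pow, div_mul_cancel₀ _ (pow_ne_zero n (frac_X_ne_zero i))]
    have h0 := pointValue_eq_zero_of_mem (p := p k) hi' (fun m x hx _ => by
      obtain ⟨x, rfl⟩ := Ideal.mem_span_singleton.mp hx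
      rw [map_mul, hpf k, zero_mul]) hmem
    rw [pointValue_sub ⟨a, _, hb, hab⟩ (isRegularAt_frac _ _), pointValue_frac,
      pointValue_eq hb hab, sub_eq_zero] at h0
    rw [hva, ← h0, map_pow, eval_X]
  · rintro ⟨g, hg, hgd, hv⟩
    refine ⟨fun i => Submodule.Quotient.mk (φ g), ⟨fun i => ?_, fun i j => ?_⟩, fun k i _ => ?_⟩
    · exact Submodule.mem_map_of_mem (frac_mem_chartSections hg hgd _)
    · exact (Submodule.factor_mk _ (φ g)).trans (Submodule.factor_mk _ (φ g)).symm
    · exact ⟨0, g, hgd, by simp, by simp [hv]⟩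

/-! ### Imposing vanishing at points: the effect on H¹ -/

/-- The forms in `I` separate the points with homogeneous coordinates `q k`. -/
def SeparatesPoints {κ : Type*} (I : Ideal (CoordRing F)) (q : κ → Fin 3 → F) : Prop :=
  ∀ k, ∃ (n : ℕ) (g : CoordRing F), g ∈ I ∧ g.IsHomogeneous n ∧ eval (q k) g ≠ 0 ∧
    ∀ l, l ≠ k → eval (q l) g = 0

/-- The forms in `I'` are the forms in `I` that vanish at the points `q k`. -/
def IsVanishingPart {κ : Type*} (I I' : Ideal (CoordRing F)) (q : κ → Fin 3 → F) : Prop :=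
  ∀ n, ∀ a : CoordRing F, a.IsHomogeneous n → (a ∈ I' ↔ a ∈ I ∧ ∀ k, eval (q k) a = 0)

section Interpolation

variable {κ : Type*} {I I' : Ideal (CoordRing F)} {q : κ → Fin 3 → F}

theorem IsVanishingPart.chartSections_le (h : IsVanishingPart I I' q) (d : ℕ)
    (T : Finset (Fin 3)) : chartSections I' d T ≤ chartSections I d T := by
  rintro _ ⟨n, a, ha, hd, rfl⟩
  exact ⟨n, a, ((h _ a hd).mp ha).1, hd, rfl⟩

theorem IsVanishingPart.pointValue_eq_zero (h : IsVanishingPart I I' q) {d : ℕ}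
    {T : Finset (Fin 3)} {y : FracField F} (hy : y ∈ chartSections I' d T) (k : κ)
    (hk : ∀ i ∈ T, q k i ≠ 0) : pointValue (q k) y = 0 :=
  pointValue_eq_zero_of_mem hk (fun n a ha had => ((h n a had).mp ha).2 k) hy

theorem IsVanishingPart.mem_chartSections (h : IsVanishingPart I I' q) {d : ℕ}
    {T : Finset (Fin 3)} {y : FracField F} (hy : y ∈ chartSections I d T)
    (h0 : ∀ k, (∀ i ∈ T, q k i ≠ 0) → pointValue (q k) y = 0) : y ∈ chartSections I' d T := by
  obtain ⟨N, hN⟩ := exists_numerator hy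
  obtain ⟨a, ha, had, hya⟩ := hN N le_rfl
  -- The additional factor ∏ X i makes the numerator vanish also at the points outside the chart,
  -- where the value of `y` says nothing.
  have hd : (a * ∏ i ∈ T, X i).IsHomogeneous (d + (N + 1) * T.card) := by
    convert had.mul (prod_X_isHomogeneous T) using 1; ring
  refine mem_chartSections_of_mul_eq (n := N + 1) ((h _ _ hd).mpr ⟨I.mul_mem_right _ ha, fun k => ?_⟩)
    hd (by rw [pow_succ, ← mul_assoc, hya, map_mul])
  by_cases hk : ∀ i ∈ T, q k i ≠ 0
  · have hb := eval_prod_X_pow_ne_zero hk N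
    have := h0 k hk
    rw [pointValue_eq (a := a) hb (by rw [map_pow, hya]), div_eq_zero_iff] at this
    rw [map_mul, this.resolve_right hb, zero_mul]
  · push Not at hk
    obtain ⟨i, hi, hi0⟩ := hk
    rw [map_mul, map_prod, Finset.prod_eq_zero hi (by simpa using hi0), mul_zero]

theorem SeparatesPoints.exists_bump (h : SeparatesPoints I q) (d : ℕ) (i : Fin 3) (k : κ) :
    ∃ t ∈ chartSections I d {i}, (q k i ≠ 0 → pointValue (q k) t = 1) ∧
      ∀ l, l ≠ k → q l i ≠ 0 → pointValue (q l) t = 0 := by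
  obtain ⟨n, g, hg, hgd, hk, hl⟩ := h k
  -- The power X i ^ d brings the degree to `d + n` over the denominator X i ^ n, and `r` normalises
  -- the value at `q k` to 1.
  set r : F := q k i ^ n * (eval (q k) g * q k i ^ d)⁻¹ with hr
  set a : CoordRing F := C r * (g * X i ^ d) with ha
  have hd : a.IsHomogeneous (d + n * ({i} : Finset (Fin 3)).card) := by
    have := (isHomogeneous_C (Fin 3) r).mul (hgd.mul ((isHomogeneous_X F i).pow d))
    convert this using 1
    simp; ring
  refine ⟨φ a / φ (∏ j ∈ {i}, X j) ^ n,
    ⟨n, a, I.mul_mem_left _ (I.mul_mem_right _ hg), hd, rfl⟩, ?_⟩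
  have hval : ∀ l, q l i ≠ 0 →
      pointValue (q l) (φ a / φ (∏ j ∈ {i}, X j) ^ n) = eval (q l) a / q l i ^ n := by
    intro l hl
    rw [pointValue_eq (a := a) (b := X i ^ n) (by simpa using fun h => (hl h).elim)]
    · simp
    · rw [Finset.prod_singleton, map_pow,
        div_mul_cancel₀ _ (pow_ne_zero n (frac_X_ne_zero i))]
  refine ⟨fun hi => ?_, fun l hlk hi => ?_⟩
  · rw [hval k hi, ha, hr]
    simp only [map_mul, eval_C, map_pow, eval_X]
    field_simp
  · rw [hval l hi, ha]
    simp [hl l hlk]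

/-- The space `N` is independent of `w`; this uniformity gives the finiteness in
`HasFiniteCharts.vanishingPart`. -/
theorem SeparatesPoints.exists_section [Finite κ] (h : SeparatesPoints I q) (d : ℕ) (i : Fin 3) :
    ∃ N : Submodule F (FracField F), N.FG ∧ ∀ w : κ → F, ∃ t ∈ N ⊓ chartSections I d {i},
      ∀ k, q k i ≠ 0 → pointValue (q k) t = w k := by
  classical
  have := Fintype.ofFinite κ
  choose t ht ht1 ht0 using h.exists_bump d i
  refine ⟨Submodule.span F (Set.range t), Submodule.fg_span (Set.finite_range t),
    fun w => ⟨∑ k, w k • t k, ⟨?_, ?_⟩, fun k hk => ?_⟩⟩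
  · exact Submodule.sum_mem _ fun k _ =>
      Submodule.smul_mem _ _ (Submodule.subset_span (Set.mem_range_self k))
  · exact Submodule.sum_mem _ fun k _ => Submodule.smul_mem _ _ (ht k)
  · have hr : ∀ l, IsRegularAt (q k) (t l) := fun l =>
      isRegularAt_of_mem (by simpa using hk) (ht l)
    rw [(IsRegularAt.sum_aux _ fun l _ => (hr l).smul (w l)).2, Finset.sum_eq_single k]
    · rw [pointValue_smul _ (hr k), ht1 k hk, mul_one]
    · intro l _ hl
      rw [pointValue_smul _ (hr l), ht0 l k hl.symm hk, mul_zero]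
    · simp

/-- Surjectivity of H¹(I') → H¹(I), from the vanishing of H¹ of a skyscraper sheaf. At `q k` the
values of `s` form a cocycle, which is the coboundary of the values of `s (i₀ k) j` for any chart
`i₀ k` containing the point. -/
theorem cechCocycles_le_sup [Finite κ] (hs : SeparatesPoints I q) (h : IsVanishingPart I I' q)
    (hq : ∀ k, q k ≠ 0) (d : ℕ) :
    cechCocycles I d ≤ cechCocycles I' d ⊔ cechCoboundaries I d := by
  rintro s ⟨hsI, hc⟩
  choose i₀ hi₀ using fun k => Function.ne_iff.mp (hq k)
  have hint : ∀ j, ∃ t ∈ chartSections I d {j},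
      ∀ k, q k j ≠ 0 → pointValue (q k) t = pointValue (q k) (s (i₀ k) j) := by
    intro j
    obtain ⟨N, -, hN⟩ := hs.exists_section d j
    obtain ⟨t, ht, htk⟩ := hN fun k => pointValue (q k) (s (i₀ k) j)
    exact ⟨t, ht.2, htk⟩
  choose t ht htv using hint
  have hcob : (fun i j => t j - t i) ∈ cechCoboundaries I d := ⟨t, ht, fun _ _ => rfl⟩
  rw [← sub_add_cancel s fun i j => t j - t i]
  refine Submodule.add_mem_sup ⟨fun i j => ?_, fun i j k => ?_⟩ hcob
  · have hti : t i ∈ chartSections I d {i, j} := chartSections_mono _ _ (by simp) (ht i)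
    have htj : t j ∈ chartSections I d {i, j} := chartSections_mono _ _ (by simp) (ht j)
    refine h.mem_chartSections
      (Submodule.sub_mem _ (hsI i j) (Submodule.sub_mem _ htj hti)) fun k hk => ?_
    have hi : q k i ≠ 0 := hk i (by simp)
    have hj : q k j ≠ 0 := hk j (by simp)
    have hr : ∀ {y}, y ∈ chartSections I d {i, j} → IsRegularAt (q k) y :=
      fun hy => isRegularAt_of_mem hk hy
    have hr0 : ∀ l, q k l ≠ 0 → IsRegularAt (q k) (s (i₀ k) l) := fun l hl =>
      isRegularAt_of_mem (by simpa using ⟨hi₀ k, hl⟩) (hsI (i₀ k) l)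
    simp only [Pi.sub_apply]
    rw [pointValue_sub (hr (hsI i j)) (hr (Submodule.sub_mem _ htj hti)),
      pointValue_sub (hr htj) (hr hti), htv i k hi, htv j k hj,
      ← pointValue_sub (hr0 j hj) (hr0 i hi), sub_eq_zero]
    congr 1
    linear_combination hc (i₀ k) i j
  · simp only [Pi.sub_apply]
    linear_combination hc i j k

/-- Injectivity of H¹(I') → H¹(I) is surjectivity of evaluation. Sections of `I` on the charts with
common values `w` have a coboundary in `I'`; it is a coboundary of `I'` exactly when they can be
corrected by sections of `I'` to a global form with values `w`. -/
theorem cechCocycles_inf_le_iff [Finite κ] (hs : SeparatesPoints I q)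
    (h : IsVanishingPart I I' q) (hq : ∀ k, q k ≠ 0)
    (hI : ∀ g : CoordRing F, (∀ i, ∃ n : ℕ, X i ^ n * g ∈ I) → g ∈ I) (d : ℕ) :
    cechCocycles I' d ⊓ cechCoboundaries I d ≤ cechCoboundaries I' d ↔
      ∀ w : κ → F, ∃ g ∈ I, g.IsHomogeneous d ∧ ∀ k, eval (q k) g = w k := by
  choose i₀ hi₀ using fun k => Function.ne_iff.mp (hq k)
  constructor
  · intro hle w
    have hint : ∀ j, ∃ t ∈ chartSections I d {j}, ∀ k, q k j ≠ 0 → pointValue (q k) t = w k := by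
      intro j
      obtain ⟨N, -, hN⟩ := hs.exists_section d j
      obtain ⟨t, ht, htk⟩ := hN w
      exact ⟨t, ht.2, htk⟩
    choose t ht htv using hint
    have hmem : (fun i j => t j - t i) ∈ cechCocycles I' d ⊓ cechCoboundaries I d := by
      refine ⟨⟨fun i j => ?_, fun i j k => by ring⟩, t, ht, fun _ _ => rfl⟩
      have hti : t i ∈ chartSections I d {i, j} := chartSections_mono _ _ (by simp) (ht i)
      have htj : t j ∈ chartSections I d {i, j} := chartSections_mono _ _ (by simp) (ht j)
      refine h.mem_chartSections (Submodule.sub_mem _ htj hti) fun k hk => ?_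
      rw [pointValue_sub (isRegularAt_of_mem hk htj) (isRegularAt_of_mem hk hti),
        htv i k (hk i (by simp)), htv j k (hk j (by simp)), sub_self]
    obtain ⟨u, hu, htu⟩ := hle hmem
    obtain ⟨g, hgI, hgd, hg⟩ := exists_global_section (d := d) (y := t 0 - u 0) hI (fun i => by
      have : t 0 - u 0 = t i - u i := by linear_combination - htu 0 i
      rw [this]
      exact Submodule.sub_mem _ (ht i) (h.chartSections_le d _ (hu i)))
    refine ⟨g, hgI, hgd, fun k => ?_⟩
    have hk : ∀ j ∈ ({i₀ k} : Finset (Fin 3)), q k j ≠ 0 := by simpa using hi₀ k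
    have hgi : φ g = t (i₀ k) - u (i₀ k) := by linear_combination - hg - htu 0 (i₀ k)
    rw [← pointValue_frac, hgi, pointValue_sub (isRegularAt_of_mem hk (ht _))
      (isRegularAt_of_mem hk (hu _)), htv _ _ (hi₀ k), h.pointValue_eq_zero (hu _) k hk, sub_zero]
  · rintro hsurj s ⟨⟨hsI, -⟩, t, ht, hst⟩
    -- As `s` has components in `I'`, the value of `t i` at `q k` is the same on every chart
    -- containing the point, so chart `i₀ k` may be used.
    obtain ⟨g, hgI, hgd, hg⟩ := hsurj fun k => pointValue (q k) (t (i₀ k))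
    refine ⟨fun i => t i - φ g, fun i => ?_, fun i j => by rw [hst]; ring⟩
    refine h.mem_chartSections
      (Submodule.sub_mem _ (ht i) (frac_mem_chartSections hgI hgd _)) fun k hk => ?_
    have hr : IsRegularAt (q k) (t (i₀ k)) :=
      isRegularAt_of_mem (by simpa using hi₀ k) (ht (i₀ k))
    have hri : IsRegularAt (q k) (t i) := isRegularAt_of_mem hk (ht i)
    rw [pointValue_sub hri (isRegularAt_frac _ _), pointValue_frac, hg, ← pointValue_sub hri hr]
    have := hsI (i₀ k) i
    rw [hst] at this
    exact h.pointValue_eq_zero this k (by simpa using ⟨hi₀ k, by simpa using hk⟩)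

end Interpolation

/-- The induced map Z'/B' → Z/B is onto with kernel (Z' ⊓ B)/B', so by rank-nullity the dimension
drops exactly when the kernel is nonzero. -/
theorem finrank_quotient_lt_iff {V : Type*} [AddCommGroup V] [Module F V]
    {Z B Z' B' : Submodule F V} (hZ : Z' ≤ Z) (hB : B' ≤ B) (hsup : Z ≤ Z' ⊔ B)
    [Module.Finite F (Z' ⧸ B'.comap Z'.subtype)] :
    Module.finrank F (Z ⧸ B.comap Z.subtype) < Module.finrank F (Z' ⧸ B'.comap Z'.subtype) ↔
      ¬ Z' ⊓ B ≤ B' := by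
  set f := Submodule.mapQ (B'.comap Z'.subtype) (B.comap Z.subtype) (Submodule.inclusion hZ)
    (fun x hx => hB hx) with hf
  have hsurj : LinearMap.range f = ⊤ := by
    rw [LinearMap.range_eq_top]
    intro y
    obtain ⟨⟨y, hy⟩, rfl⟩ := Submodule.mkQ_surjective _ y
    obtain ⟨a, ha, b, hb, rfl⟩ := Submodule.mem_sup.mp (hsup hy)
    refine ⟨Submodule.Quotient.mk ⟨a, ha⟩, ?_⟩
    rw [hf, Submodule.mapQ_apply, Submodule.mkQ_apply, Submodule.Quotient.eq,
      Submodule.mem_comap]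
    simpa using hb
  have hker : LinearMap.ker f = ⊥ ↔ Z' ⊓ B ≤ B' := by
    rw [LinearMap.ker_eq_bot']
    constructor
    · rintro h x ⟨hx, hxB⟩
      have := h (Submodule.Quotient.mk ⟨x, hx⟩)
        (by rw [hf, Submodule.mapQ_apply, Submodule.Quotient.mk_eq_zero]; exact hxB)
      rw [Submodule.Quotient.mk_eq_zero] at this
      exact this
    · intro h y hy
      obtain ⟨⟨y, hyZ⟩, rfl⟩ := Submodule.mkQ_surjective _ y
      rw [Submodule.mkQ_apply, hf, Submodule.mapQ_apply, Submodule.Quotient.mk_eq_zero] at hy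
      rw [Submodule.mkQ_apply, Submodule.Quotient.mk_eq_zero]
      exact h ⟨hyZ, hy⟩
  have h1 := LinearMap.finrank_range_add_finrank_ker f
  rw [hsurj, finrank_top] at h1
  rw [← hker, ← Submodule.finrank_eq_zero (S := LinearMap.ker f)]
  omega

theorem h1_lt_iff {κ : Type*} [Finite κ] {Z Z' : Subscheme F} {q : κ → Fin 3 → F}
    (hs : SeparatesPoints Z.ideal q) (h : IsVanishingPart Z.ideal Z'.ideal q)
    (hq : ∀ k, q k ≠ 0) (d : ℕ) [Module.Finite F (H1 Z' d)] :
    h1 Z d < h1 Z' d ↔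
      ¬ ∀ w : κ → F, ∃ g ∈ Z.ideal, g.IsHomogeneous d ∧ ∀ k, eval (q k) g = w k := by
  rw [← cechCocycles_inf_le_iff hs h hq Z.saturated d]
  refine finrank_quotient_lt_iff ?_ ?_ (cechCocycles_le_sup hs h hq d)
  · rintro s ⟨hs, hc⟩
    exact ⟨fun i j => h.chartSections_le d _ (hs i j), hc⟩
  · rintro s ⟨t, ht, hst⟩
    exact ⟨t, fun i => h.chartSections_le d _ (ht i), hst⟩

/-! ### Finite-dimensionality of H¹ -/

theorem finite_quotient_comap_of_le_sup {V : Type*} [AddCommGroup V] [Module F V]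
    {Z B N : Submodule F V} (hN : N.FG) (h : Z ≤ B ⊔ N) :
    Module.Finite F (Z ⧸ B.comap Z.subtype) := by
  have : Module.Finite F (N.map B.mkQ) := Module.Finite.iff_fg.mpr (hN.map _)
  have hr : ∀ y, Submodule.mapQ (B.comap Z.subtype) B Z.subtype le_rfl y ∈ N.map B.mkQ := by
    intro y
    obtain ⟨⟨y, hy⟩, rfl⟩ := Submodule.mkQ_surjective _ y
    obtain ⟨b, hb, n, hn, rfl⟩ := Submodule.mem_sup.mp (h hy)
    refine ⟨n, hn, ?_⟩
    rw [Submodule.mkQ_apply, Submodule.mkQ_apply, Submodule.mapQ_apply, eq_comm,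
      Submodule.Quotient.eq]
    simpa using hb
  refine Module.Finite.of_injective
    ((Submodule.mapQ (B.comap Z.subtype) B Z.subtype le_rfl).codRestrict _ hr) ?_
  rw [← LinearMap.ker_eq_bot, LinearMap.ker_codRestrict, LinearMap.ker_eq_bot']
  intro y hy
  obtain ⟨y, rfl⟩ := Submodule.mkQ_surjective _ y
  rw [Submodule.mkQ_apply, Submodule.mapQ_apply, Submodule.Quotient.mk_eq_zero] at hy
  rwa [Submodule.mkQ_apply, Submodule.Quotient.mk_eq_zero]

/-- The sections of `(𝒪 / Ĩ)(d)` over the standard charts are finite-dimensional. -/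
def HasFiniteCharts (I : Ideal (CoordRing F)) (d : ℕ) : Prop :=
  ∀ i, ∃ N : Submodule F (FracField F), N.FG ∧
    chartSections ⊤ d {i} ≤ chartSections I d {i} ⊔ N

/-- Subtracting an interpolating section from a fixed finite-dimensional space makes a section of
`I` vanish at the points, hence lie in `I'`. -/
theorem HasFiniteCharts.vanishingPart {κ : Type*} [Finite κ] {I I' : Ideal (CoordRing F)}
    {q : κ → Fin 3 → F} {d : ℕ} (hI : HasFiniteCharts I d) (hs : SeparatesPoints I q)
    (h : IsVanishingPart I I' q) : HasFiniteCharts I' d := by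
  intro i
  obtain ⟨N, hN, hle⟩ := hI i
  obtain ⟨N', hN', ht⟩ := hs.exists_section d i
  refine ⟨N' ⊔ N, hN'.sup hN, fun y hy => ?_⟩
  obtain ⟨a, ha, b, hb, rfl⟩ := Submodule.mem_sup.mp (hle hy)
  obtain ⟨t, htm, htv⟩ := ht fun k => pointValue (q k) a
  have hat : a - t ∈ chartSections I' d {i} := by
    refine h.mem_chartSections (Submodule.sub_mem _ ha htm.2) fun k hk => ?_
    rw [pointValue_sub (isRegularAt_of_mem hk ha) (isRegularAt_of_mem hk htm.2),
      htv k (by simpa using hk), sub_self]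
  rw [← sub_add_cancel a t, add_assoc]
  exact Submodule.add_mem_sup hat (Submodule.add_mem_sup htm.1 hb)

/-- A cocycle of the ideal is a coboundary in 𝒪(d), because H¹(𝒪(d)) = 0. Modulo coboundaries of the
ideal, its primitive matters only through its components in the finite-dimensional spaces `N i`. -/
theorem HasFiniteCharts.finite_H1 {Z : Subscheme F} {d : ℕ} (h : HasFiniteCharts Z.ideal d) :
    Module.Finite F (H1 Z d) := by
  choose N hN hle using h
  let δ : (Fin 3 → FracField F) →ₗ[F] (Fin 3 → Fin 3 → FracField F) :=
    { toFun := fun t i j => t j - t i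
      map_add' := fun t u => by ext i j; simp only [Pi.add_apply]; ring
      map_smul' := fun r t => by
        ext i j; simp only [Pi.smul_apply, RingHom.id_apply, smul_sub] }
  refine finite_quotient_comap_of_le_sup (N := (Submodule.pi Set.univ N).map δ)
    ((Submodule.fg_pi hN).map δ) ?_
  rintro s ⟨hs, hc⟩
  have hs' : s ∈ cechCocycles (Ideal.span {(1 : CoordRing F)}) d :=
    ⟨fun i j => chartSections_mono_ideal (by simp) d _ (hs i j), hc⟩
  obtain ⟨t, ht, hst⟩ := cechCocycles_span_le d (isHomogeneous_one _ _) one_ne_zero hs'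
  rw [Ideal.span_singleton_one] at ht
  choose a ha b hb hab using fun i => Submodule.mem_sup.mp (hle i (ht i))
  refine Submodule.mem_sup.mpr ⟨δ a, ⟨a, ha, fun _ _ => rfl⟩, δ b,
    Submodule.mem_map_of_mem fun i _ => hb i, ?_⟩
  ext i j
  simp only [hst, ← hab, Pi.add_apply, δ, LinearMap.coe_mk, AddHom.coe_mk]
  ring

/-- In dimension at most 0 every irreducible closed set is maximal, so nested point closures
coincide. -/
theorem specializes_symm_of_topologicalKrullDim_nonpos {T : Type*} [TopologicalSpace T]
    (h : topologicalKrullDim T ≤ 0) {x y : T} (hxy : x ⤳ y) : y ⤳ x := by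
  have hmax := Order.krullDim_nonpos_iff_forall_isMax.mp h
  let c : T → TopologicalSpace.IrreducibleCloseds T := fun z =>
    ⟨closure {z}, isIrreducible_singleton.closure, isClosed_closure⟩
  have hle : c y ≤ c x := hxy.closure_subset
  have := hmax (c y) hle
  exact specializes_iff_mem_closure.mpr (this (subset_closure rfl))

theorem exists_homogeneous_sub_mem (i : Fin 3) (g : CoordRing F) :
    ∃ n, ∃ G : CoordRing F, G.IsHomogeneous n ∧ G - g ∈ Ideal.span {(X i - 1 : CoordRing F)} := by
  refine ⟨g.totalDegree, ∑ n ∈ Finset.range (g.totalDegree + 1),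
    homogeneousComponent n g * X i ^ (g.totalDegree - n), ?_, ?_⟩
  · refine IsHomogeneous.sum _ _ _ fun n hn => ?_
    have hn' : n ≤ g.totalDegree := Nat.lt_succ_iff.mp (Finset.mem_range.mp hn)
    convert (homogeneousComponent_isHomogeneous n g).mul
      ((isHomogeneous_X F i).pow (g.totalDegree - n)) using 1
    omega
  · have h : ∑ n ∈ Finset.range (g.totalDegree + 1),
        homogeneousComponent n g * X i ^ (g.totalDegree - n) - g =
        ∑ n ∈ Finset.range (g.totalDegree + 1),
          homogeneousComponent n g * (X i ^ (g.totalDegree - n) - 1) := by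
      simp only [mul_sub, mul_one, Finset.sum_sub_distrib, sum_homogeneousComponent]
    rw [h, Ideal.mem_span_singleton]
    refine Finset.dvd_sum fun n _ => Dvd.dvd.mul_left ?_ _
    simpa using sub_dvd_pow_sub_pow (X i : CoordRing F) 1 (g.totalDegree - n)

/-- Primes containing X i - 1 and the ideal of `Z` give points of `Z` through their homogeneous
cores. Such a prime is determined by its core, since modulo X i - 1 every polynomial is congruent to
a form. -/
theorem Subscheme.IsZeroDimensional.le_of_le {Z : Subscheme F} (hZ : Z.IsZeroDimensional)
    (i : Fin 3) {P Q : Ideal (CoordRing F)} [hP : P.IsPrime] [hQ : Q.IsPrime]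
    (hJ : Z.ideal ⊔ Ideal.span {X i - 1} ≤ P) (hPQ : P ≤ Q) : Q ≤ P := by
  let pt : ∀ (P : Ideal (CoordRing F)) (_ : P.IsPrime) (_ : Z.ideal ⊔ Ideal.span {X i - 1} ≤ P),
      Z.support := fun P hP hJ =>
    ⟨⟨P.homogeneousCore (homogeneousSubmodule (Fin 3) F), hP.homogeneousCore, fun h => by
      have hX : (X i : CoordRing F) ∈ P := by
        exact Ideal.toIdeal_homogeneousCore_le _ P
          (h (HomogeneousIdeal.mem_irrelevant_of_mem _ one_pos (isHomogeneous_X F i)))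
      have h1 : (X i - 1 : CoordRing F) ∈ P :=
        hJ (Ideal.mem_sup_right (Ideal.mem_span_singleton_self _))
      exact hP.ne_top ((Ideal.eq_top_iff_one _).mpr (by simpa using P.sub_mem hX h1))⟩, by
      have h1 : Z.ideal ≤ P := le_sup_left.trans hJ
      have h2 := Ideal.homogeneousCore_mono (homogeneousSubmodule (Fin 3) F) h1
      intro x hx
      refine h2 ?_
      have h3 := Z.homogeneous.toIdeal_homogeneousCore_eq_self
      exact (h3.symm ▸ hx : x ∈ (Z.ideal.homogeneousCore _).toIdeal)⟩
  have hle : (pt P hP hJ : ProjectiveSpectrum (homogeneousSubmodule (Fin 3) F)) ≤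
      pt Q hQ (hJ.trans hPQ) := Ideal.homogeneousCore_mono (homogeneousSubmodule (Fin 3) F) hPQ
  rw [ProjectiveSpectrum.le_iff_mem_closure, ← specializes_iff_mem_closure,
    ← subtype_specializes_iff] at hle
  have hge := specializes_symm_of_topologicalKrullDim_nonpos hZ hle
  rw [subtype_specializes_iff, specializes_iff_mem_closure,
    ← ProjectiveSpectrum.le_iff_mem_closure] at hge
  intro g hg
  obtain ⟨n, G, hG, hGg⟩ := exists_homogeneous_sub_mem i g
  have hGP : G - g ∈ P := hJ (Ideal.mem_sup_right hGg)
  have hGQ : G ∈ Q := by simpa using Q.add_mem (hPQ hGP) hg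
  have hGQ' : G ∈ Q.homogeneousCore (homogeneousSubmodule (Fin 3) F) :=
    Ideal.mem_homogeneousCore_of_homogeneous_of_mem ⟨n, hG⟩ hGQ
  have hGP' : G ∈ P := Ideal.toIdeal_homogeneousCore_le _ P (hge hGQ')
  simpa using P.sub_mem hGP' hGP

/-- All primes of this finitely generated algebra, the coordinate ring of `Z` on the chart, are
maximal, so it is finite over the field. -/
theorem Subscheme.IsZeroDimensional.finite_quotient {Z : Subscheme F}
    (hZ : Z.IsZeroDimensional) (i : Fin 3) :
    Module.Finite F (CoordRing F ⧸ (Z.ideal ⊔ Ideal.span {X i - 1})) := by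
  rw [Module.finite_iff_krullDimLE_zero, Ring.krullDimLE_zero_iff]
  intro P hP
  obtain ⟨M, hM, hPM⟩ := P.exists_le_maximal hP.ne_top
  have hMP : M ≤ P := by
    rw [← Ideal.comap_le_comap_iff_of_surjective _ Ideal.Quotient.mk_surjective]
    have := hM.isPrime
    refine hZ.le_of_le i ?_ (Ideal.comap_mono hPM)
    exact (Ideal.mk_ker (I := Z.ideal ⊔ Ideal.span {X i - 1})).ge.trans (Ideal.comap_mono bot_le)
  rwa [le_antisymm hPM hMP]

theorem aeval_div_of_isHomogeneous (i : Fin 3) {a : CoordRing F} {m : ℕ}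
    (ha : a.IsHomogeneous m) :
    aeval (fun j => φ (X j) / φ (X i)) a * φ (X i) ^ m = φ a := by
  have h0 := frac_X_ne_zero (F := F) i
  have h : φ a = aeval (fun j => φ (X j)) a := by
    simpa [Function.comp_def] using (aeval_algebraMap_apply (FracField F) (X : Fin 3 → CoordRing F) a).symm
  rw [h, aeval_def, aeval_def, eval₂_eq', eval₂_eq', Finset.sum_mul]
  refine Finset.sum_congr rfl fun s hs => ?_
  have hsm : ∑ j, s j = m := by
    have := ha (mem_support_iff.mp hs)
    rw [Finsupp.weight_apply, Finsupp.sum_fintype _ _ (by simp)] at this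
    simpa using this
  rw [← hsm, ← Finset.prod_pow_eq_pow_sum, mul_assoc, ← Finset.prod_mul_distrib]
  congr 1
  refine Finset.prod_congr rfl fun j _ => ?_
  rw [div_pow, div_mul_cancel₀ _ (pow_ne_zero _ h0)]

/-- Dehomogenisation X j ↦ X j / X i, followed by multiplication by X i ^ d, maps polynomials onto
the sections of 𝒪(d) on the chart. It kills X i - 1 and sends the ideal of `Z` to its own sections,
so lifts of generators of the finite quotient suffice. -/
theorem Subscheme.IsZeroDimensional.hasFiniteCharts {Z : Subscheme F}
    (hZ : Z.IsZeroDimensional) (d : ℕ) : HasFiniteCharts Z.ideal d := by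
  intro i
  have h0 := frac_X_ne_zero (F := F) i
  have hfin := hZ.finite_quotient i
  obtain ⟨n, s, hs⟩ := Module.Finite.exists_fin (R := F)
    (M := CoordRing F ⧸ (Z.ideal ⊔ Ideal.span {X i - 1}))
  choose r hr using fun k => Ideal.Quotient.mk_surjective (s k)
  let ψ : CoordRing F →ₐ[F] FracField F := aeval fun j => φ (X j) / φ (X i)
  let Ψ : CoordRing F →ₗ[F] FracField F :=
    LinearMap.mulLeft F (φ (X i) ^ d) ∘ₗ ψ.toLinearMap
  have hΨ : ∀ g, Ψ g = φ (X i) ^ d * ψ g := fun _ => rfl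
  have hψ : ∀ {m : ℕ} {a : CoordRing F}, a.IsHomogeneous m → ψ a * φ (X i) ^ m = φ a :=
    fun ha => aeval_div_of_isHomogeneous i ha
  have hΨh : ∀ (m : ℕ), ∀ a ∈ Z.ideal, a.IsHomogeneous m → Ψ a ∈ chartSections Z.ideal d {i} := by
    intro m a ha had
    refine mem_chartSections_of_mul_eq (n := m) (a := X i ^ d * a) (Z.ideal.mul_mem_left _ ha) ?_ ?_
    · simpa using ((isHomogeneous_X F i).pow d).mul had
    · rw [Finset.prod_singleton, hΨ, mul_assoc, hψ had, map_mul, map_pow]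
  have hΨJ : ∀ a ∈ Z.ideal ⊔ Ideal.span {(X i - 1 : CoordRing F)},
      Ψ a ∈ chartSections Z.ideal d {i} := by
    intro a ha
    obtain ⟨b, hb, c, hc, rfl⟩ := Submodule.mem_sup.mp ha
    obtain ⟨c, rfl⟩ := Ideal.mem_span_singleton.mp hc
    have hc0 : Ψ ((X i - 1) * c) = 0 := by
      rw [hΨ, map_mul, map_sub, map_one, aeval_X, div_self h0]; simp
    rw [map_add, hc0, add_zero, ← sum_homogeneousComponent b, map_sum]
    exact Submodule.sum_mem _ fun m _ => hΨh m _
      (homogeneousComponent_mem_of_mem Z.homogeneous hb m)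
      (homogeneousComponent_isHomogeneous m b)
  refine ⟨(Submodule.span F (Set.range r)).map Ψ,
    (Submodule.fg_span (Set.finite_range r)).map Ψ, ?_⟩
  rintro _ ⟨m, a, -, had, rfl⟩
  have hay : Ψ a = φ a / φ (∏ j ∈ {i}, X j) ^ m := by
    rw [Finset.prod_singleton, eq_div_iff (pow_ne_zero m h0), hΨ]
    have := hψ had
    simp only [Finset.card_singleton, mul_one, pow_add] at this
    linear_combination this
  rw [← hay]
  have hmem : Ideal.Quotient.mk (Z.ideal ⊔ Ideal.span {X i - 1}) a ∈
      Submodule.span F (Set.range s) := hs ▸ Submodule.mem_top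
  obtain ⟨w, hw⟩ := (Submodule.mem_span_range_iff_exists_fun F).mp hmem
  have hJ : a - ∑ k, w k • r k ∈ Z.ideal ⊔ Ideal.span {(X i - 1 : CoordRing F)} := by
    rw [← Ideal.Quotient.eq, ← hw, ← Ideal.Quotient.mkₐ_eq_mk F, map_sum]
    simp only [map_smul, Ideal.Quotient.mkₐ_eq_mk, hr]
  rw [← sub_add_cancel a (∑ k, w k • r k), map_add]
  exact Submodule.add_mem_sup (hΨJ _ hJ) (Submodule.mem_map_of_mem
    (Submodule.sum_mem _ fun k _ => Submodule.smul_mem _ _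
      (Submodule.subset_span (Set.mem_range_self k))))

/-! ### Ideals of points in homogeneous coordinates -/

theorem IsSmoothCurve.ne_zero {f : CoordRing F} {c : ℕ} (hf : IsSmoothCurve f c) : f ≠ 0 := by
  rintro rfl
  obtain ⟨i, hi⟩ := hf.2 (fun _ => 1) (Function.ne_iff.mpr ⟨0, one_ne_zero⟩) (map_zero _)
  simp at hi

theorem eval_smul_of_isHomogeneous {a : CoordRing F} {n : ℕ} (ha : a.IsHomogeneous n) (t : F)
    (p : Fin 3 → F) : eval (t • p) a = t ^ n * eval p a := by
  have h := congrArg (Polynomial.aeval t) (aeval_line_of_isHomogeneous p ha)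
  rw [comp_aeval_apply] at h
  simp only [map_mul, Polynomial.aeval_C, Polynomial.aeval_X, map_pow, Algebra.algebraMap_self,
    RingHom.id_apply] at h
  rw [mul_comm, ← h]
  congr 2
  ext i
  simp [mul_comm]

theorem mem_pointIdeal_iff_of_isHomogeneous {a : CoordRing F} {n : ℕ} (ha : a.IsHomogeneous n)
    (p : Fin 3 → F) : a ∈ pointIdeal p ↔ eval p a = 0 := by
  rw [pointIdeal, RingHom.mem_ker, aeval_line_of_isHomogeneous p ha]
  simp

theorem eval_rep_eq_zero_iff {a : CoordRing F} {n : ℕ} (ha : a.IsHomogeneous n) {P : Point F}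
    {p : Fin 3 → F} (h0 : p ≠ 0) (hp : Projectivization.mk F p h0 = P) :
    eval P.rep a = 0 ↔ eval p a = 0 := by
  have h : Projectivization.mk F P.rep P.rep_nonzero = Projectivization.mk F p h0 := by
    rw [P.mk_rep, hp]
  obtain ⟨t, ht⟩ := (Projectivization.mk_eq_mk_iff' F _ _ _ _).mp h
  have ht0 : t ≠ 0 := by
    rintro rfl
    exact P.rep_nonzero (by rw [← ht, zero_smul])
  rw [← ht, eval_smul_of_isHomogeneous ha]
  simp [ht0]

theorem mem_ofPoints_iff {a : CoordRing F} {n : ℕ} (ha : a.IsHomogeneous n)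
    (S : Finset (Point F)) :
    a ∈ (Subscheme.ofPoints S).ideal ↔ ∀ P ∈ S, eval P.rep a = 0 := by
  simp only [Subscheme.ofPoints, Submodule.mem_iInf]
  exact forall₂_congr fun P _ => mem_pointIdeal_iff_of_isHomogeneous ha _

theorem exists_linear_form {p q : Fin 3 → F} (hp : p ≠ 0) (hq : q ≠ 0)
    (h : Projectivization.mk F p hp ≠ Projectivization.mk F q hq) :
    ∃ L : CoordRing F, L.IsHomogeneous 1 ∧ eval p L ≠ 0 ∧ eval q L = 0 := by
  by_contra! hL
  refine h ((Projectivization.mk_eq_mk_iff' F _ _ _ _).mpr ?_)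
  obtain ⟨j, hj⟩ := Function.ne_iff.mp hq
  refine ⟨p j / q j, funext fun i => ?_⟩
  by_contra hi
  -- A 2 × 2 minor of the coordinates: it vanishes at `q`, and at `p` it measures the failure of
  -- proportionality.
  refine hL (C (q j) * X i - C (q i) * X j) ?_ ?_ ?_
  · exact ((isHomogeneous_X F i).C_mul _).sub ((isHomogeneous_X F j).C_mul _)
  · intro h0
    simp only [map_sub, map_mul, eval_C, eval_X] at h0
    apply hi
    rw [Pi.smul_apply, smul_eq_mul, div_mul_eq_mul_div, div_eq_iff hj]
    linear_combination -h0
  · simp only [map_sub, map_mul, eval_C, eval_X]; ring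

/-- `p` is a choice of homogeneous coordinates for the points of `B`. -/
def IsCoordinates {B : Finset (Point F)} (p : B → Fin 3 → F) : Prop :=
  ∀ P : B, ∃ h : p P ≠ 0, Projectivization.mk F (p P) h = P

section Points

variable {B : Finset (Point F)} {p : B → Fin 3 → F}

/-- A form of `I` that is nonzero at the chosen point is multiplied by lines that pass through the
other points and miss this one. -/
theorem separatesPoints (hp : IsCoordinates p) {I : Ideal (CoordRing F)}
    (hI : I.IsHomogeneous (homogeneousSubmodule (Fin 3) F))
    (hIB : ∀ P : B, ¬ I ≤ pointIdeal (p P)) : SeparatesPoints I p := by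
  classical
  intro k
  obtain ⟨g, hg, hgk⟩ := Set.not_subset.mp (hIB k)
  have hgk' : ¬ ∀ n, eval (p k) (homogeneousComponent n g) = 0 := fun h =>
    hgk ((mem_pointIdeal_iff _ _).mpr h)
  push Not at hgk'
  obtain ⟨n, hn⟩ := hgk'
  have hL : ∀ l, ∃ L : CoordRing F, L.IsHomogeneous 1 ∧ (l ≠ k → eval (p k) L ≠ 0 ∧
      eval (p l) L = 0) := by
    intro l
    by_cases hl : l = k
    · exact ⟨X 0, isHomogeneous_X F 0, fun h => (h hl).elim⟩
    · obtain ⟨hk0, hk⟩ := hp k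
      obtain ⟨hl0, hl'⟩ := hp l
      obtain ⟨L, h1, h2⟩ := exists_linear_form hk0 hl0
        (by rw [hk, hl']; exact fun h => hl (Subtype.ext h).symm)
      exact ⟨L, h1, fun _ => h2⟩
  choose L hL1 hL2 using hL
  refine ⟨_, homogeneousComponent n g * ∏ l ∈ Finset.univ.erase k, L l,
    I.mul_mem_right _ (homogeneousComponent_mem_of_mem hI hg n),
    (homogeneousComponent_isHomogeneous n g).mul (IsHomogeneous.prod _ _ (fun _ => 1)
      fun l _ => hL1 l), ?_, fun l hl => ?_⟩
  · rw [map_mul, map_prod]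
    exact mul_ne_zero hn (Finset.prod_ne_zero_iff.mpr fun l hl =>
      (hL2 l (Finset.ne_of_mem_erase hl)).1)
  · rw [map_mul, map_prod, Finset.prod_eq_zero (Finset.mem_erase.mpr ⟨hl, Finset.mem_univ l⟩)
      (hL2 l hl).2, mul_zero]

theorem mem_union_ofPoints_iff (hp : IsCoordinates p) (E : Subscheme F) {S : Finset (Point F)}
    (hS : S ⊆ B) {a : CoordRing F} {n : ℕ} (ha : a.IsHomogeneous n) :
    a ∈ (E.union (Subscheme.ofPoints S)).ideal ↔
      a ∈ E.ideal ∧ ∀ k : B, (k : Point F) ∈ S → eval (p k) a = 0 := by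
  have h : a ∈ (E.union (Subscheme.ofPoints S)).ideal ↔
      a ∈ E.ideal ∧ a ∈ (Subscheme.ofPoints S).ideal := Iff.rfl
  rw [h, mem_ofPoints_iff ha]
  refine and_congr_right fun _ => ⟨fun h k hk => ?_, fun h P hP => ?_⟩
  · obtain ⟨h0, hk'⟩ := hp k
    exact (eval_rep_eq_zero_iff ha h0 hk').mp (h k hk)
  · obtain ⟨h0, hk'⟩ := hp ⟨P, hS hP⟩
    exact (eval_rep_eq_zero_iff ha h0 hk').mpr (h ⟨P, hS hP⟩ hP)

variable {E : Subscheme F} {S S' : Finset (Point F)} {d : ℕ}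

theorem isVanishingPart_union (hp : IsCoordinates p) (E : Subscheme F) (hS : S ⊆ B) :
    IsVanishingPart E.ideal (E.union (Subscheme.ofPoints S)).ideal
      (fun k : {k : B // (k : Point F) ∈ S} => p k) := by
  intro n a ha
  rw [mem_union_ofPoints_iff hp E hS ha]
  simp only [Subtype.forall]

theorem isVanishingPart_union_union (hp : IsCoordinates p) (E : Subscheme F) (hS : S ⊆ B)
    (hS' : S' ⊆ S) :
    IsVanishingPart (E.union (Subscheme.ofPoints S')).ideal
      (E.union (Subscheme.ofPoints S)).ideal
      (fun k : {k : B // (k : Point F) ∈ S ∧ (k : Point F) ∉ S'} => p k) := by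
  intro n a ha
  rw [mem_union_ofPoints_iff hp E hS ha, mem_union_ofPoints_iff hp E (hS'.trans hS) ha]
  constructor
  · rintro ⟨h1, h2⟩
    exact ⟨⟨h1, fun k hk => h2 k (hS' hk)⟩, fun k => h2 k k.2.1⟩
  · rintro ⟨⟨h1, h2⟩, h3⟩
    refine ⟨h1, fun k hk => ?_⟩
    by_cases hk' : (k : Point F) ∈ S'
    · exact h2 k hk'
    · exact h3 ⟨k, hk, hk'⟩

theorem SeparatesPoints.union (hp : IsCoordinates p) (hs : SeparatesPoints E.ideal p)
    (hS : S ⊆ B) (hS' : S' ⊆ S) :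
    SeparatesPoints (E.union (Subscheme.ofPoints S')).ideal
      (fun k : {k : B // (k : Point F) ∈ S ∧ (k : Point F) ∉ S'} => p k) := by
  rintro ⟨k, hk, hk'⟩
  obtain ⟨n, g, hg, hgn, hgk, hgl⟩ := hs k
  refine ⟨n, g, (mem_union_ofPoints_iff hp E (hS'.trans hS) hgn).mpr ⟨hg, fun l hl => hgl l ?_⟩,
    hgn, hgk, fun l hl => hgl l fun h => hl (Subtype.ext h)⟩
  rintro rfl
  exact hk' hl

theorem SeparatesPoints.subtype (hs : SeparatesPoints E.ideal p) (Q : B → Prop) :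
    SeparatesPoints E.ideal (fun k : {k : B // Q k} => p k) := by
  rintro ⟨k, hk⟩
  obtain ⟨n, g, hg, hgn, hgk, hgl⟩ := hs k
  exact ⟨n, g, hg, hgn, hgk, fun l hl => hgl l fun h => hl (Subtype.ext h)⟩

theorem finite_H1_union (hp : IsCoordinates p) (hs : SeparatesPoints E.ideal p)
    (hE : E.IsZeroDimensional) (hS : S ⊆ B) (d : ℕ) :
    Module.Finite F (H1 (E.union (Subscheme.ofPoints S)) d) :=
  ((hE.hasFiniteCharts d).vanishingPart (hs.subtype _) (isVanishingPart_union hp E hS)).finite_H1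

/-! ### Dual words and jumps of h¹ -/

/-- The words orthogonal to the values at the points of `B` of the forms of degree `d` in `E`. -/
def IsOrthogonal (E : Subscheme F) (d : ℕ) (p : B → Fin 3 → F) (v : B → F) : Prop :=
  ∀ g ∈ E.ideal, g.IsHomogeneous d → ∑ k, v k * eval (p k) g = 0

theorem exists_dotProduct_eq_zero {κ : Type*} [Fintype κ] {W : Submodule F (κ → F)}
    (hW : W ≠ ⊤) : ∃ u : κ → F, u ≠ 0 ∧ ∀ w ∈ W, ∑ k, u k * w k = 0 := by
  classical
  obtain ⟨f, hf0, hf⟩ := Submodule.exists_le_ker_of_lt_top W (lt_top_iff_ne_top.mpr hW)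
  have hsum : ∀ w, f w = ∑ k, f (Pi.single k 1) * w k := by
    intro w
    conv_lhs => rw [← Finset.univ_sum_single w]
    rw [map_sum]
    refine Finset.sum_congr rfl fun k _ => ?_
    rw [show Pi.single k (w k) = w k • (Pi.single k 1 : κ → F) by
      rw [← Pi.single_smul, smul_eq_mul, mul_one], map_smul, smul_eq_mul, mul_comm]
  refine ⟨fun k => f (Pi.single k 1), fun h => hf0 (LinearMap.ext fun w => ?_), fun w hw => ?_⟩
  · rw [hsum w, LinearMap.zero_apply]
    exact Finset.sum_eq_zero fun k _ => by rw [congrFun h k, Pi.zero_apply, zero_mul]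
  · rw [← hsum]
    exact hf hw

/-- Evaluation at `S` fails to be onto exactly when a nonzero functional kills its image; extended
by zero to `B`, this functional is the word. -/
theorem h1_lt_h1_union_iff (hp : IsCoordinates p) (hs : SeparatesPoints E.ideal p)
    (hE : E.IsZeroDimensional) (hS : S ⊆ B) (d : ℕ) :
    h1 E d < h1 (E.union (Subscheme.ofPoints S)) d ↔
      ∃ v, IsOrthogonal E d p v ∧ v ≠ 0 ∧ ∀ k : B, v k ≠ 0 → (k : Point F) ∈ S := by
  classical
  have := finite_H1_union hp hs hE hS d
  rw [h1_lt_iff (hs.subtype _) (isVanishingPart_union hp E hS) (fun k => (hp k).1)]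
  constructor
  · intro h
    let W : Submodule F ({k : B // (k : Point F) ∈ S} → F) :=
      { carrier := {w | ∃ g ∈ E.ideal, g.IsHomogeneous d ∧ ∀ k, eval (p k.1) g = w k}
        zero_mem' := ⟨0, E.ideal.zero_mem, isHomogeneous_zero _ _ _, by simp⟩
        add_mem' := by
          rintro w w' ⟨g, hg, hgd, hw⟩ ⟨g', hg', hgd', hw'⟩
          exact ⟨g + g', E.ideal.add_mem hg hg', hgd.add hgd', by simp [hw, hw']⟩
        smul_mem' := by
          rintro r w ⟨g, hg, hgd, hw⟩
          exact ⟨C r * g, E.ideal.mul_mem_left _ hg, hgd.C_mul r, by simp [hw]⟩ }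
    obtain ⟨u, hu0, hu⟩ := exists_dotProduct_eq_zero (W := W)
      fun hW => h fun w => (hW ▸ Submodule.mem_top : w ∈ W)
    refine ⟨fun k => if hk : (k : Point F) ∈ S then u ⟨k, hk⟩ else 0, fun g hg hgd => ?_,
      fun h0 => hu0 (funext fun k => ?_), fun k hk => ?_⟩
    · have h1 := hu (fun k => eval (p k.1) g) ⟨g, hg, hgd, fun _ => rfl⟩
      refine Eq.trans ?_ h1
      rw [← Fintype.sum_subtype_add_sum_subtype (fun k : B => (k : Point F) ∈ S),
        Finset.sum_eq_zero (s := Finset.univ (α := {k : B // (k : Point F) ∉ S})), add_zero]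
      · exact Finset.sum_congr rfl fun k _ => by simp only [dif_pos k.2]
      · exact fun k _ => by simp only [dif_neg k.2, zero_mul]
    · have := congrFun h0 k.1
      simpa [k.2] using this
    · by_contra hkS
      exact hk (dif_neg hkS)
  · rintro ⟨v, hv, hv0, hvS⟩ hsurj
    obtain ⟨k₀, hk₀⟩ := Function.ne_iff.mp hv0
    -- A form that is 1 at `k₀` and 0 at the rest of `S` pairs with `v` to `v k₀`, which is nonzero.
    obtain ⟨g, hg, hgd, hgw⟩ := hsurj (Pi.single ⟨k₀, hvS k₀ hk₀⟩ 1)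
    have h0 := hv g hg hgd
    rw [Finset.sum_eq_single k₀ _ (by simp)] at h0
    · rw [hgw ⟨k₀, hvS k₀ hk₀⟩, Pi.single_eq_same, mul_one] at h0
      exact hk₀ h0
    · intro k _ hk
      by_cases hvk : v k = 0
      · rw [hvk, zero_mul]
      · rw [hgw ⟨k, hvS k hvk⟩, Pi.single_eq_of_ne (fun h => hk (congrArg Subtype.val h)), mul_zero]

/-- If evaluation of the forms through `E` and `S'` were onto at the points of `S` outside `S'`, one
of them would be 1 at some `P` there and 0 at the rest of `S`. Pairing with `v` would give the
nonzero entry at `P`. -/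
theorem h1_union_lt_h1_union (hp : IsCoordinates p) (hs : SeparatesPoints E.ideal p)
    (hE : E.IsZeroDimensional) (hS : S ⊆ B) {v : B → F} (hv : IsOrthogonal E d p v)
    (hvS : ∀ k : B, v k ≠ 0 ↔ (k : Point F) ∈ S) (hS' : S' ⊂ S) :
    h1 (E.union (Subscheme.ofPoints S')) d < h1 (E.union (Subscheme.ofPoints S)) d := by
  classical
  have := finite_H1_union hp hs hE hS d
  rw [h1_lt_iff (hs.union hp hS hS'.subset) (isVanishingPart_union_union hp E hS hS'.subset)
    (fun k => (hp k).1)]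
  intro hsurj
  obtain ⟨P, hPS, hPS'⟩ := Finset.exists_of_ssubset hS'
  obtain ⟨g, hg, hgd, hgw⟩ := hsurj (Pi.single ⟨⟨P, hS hPS⟩, hPS, hPS'⟩ 1)
  rw [mem_union_ofPoints_iff hp E (hS'.subset.trans hS) hgd] at hg
  have h0 := hv g hg.1 hgd
  rw [Finset.sum_eq_single ⟨P, hS hPS⟩ _ (by simp)] at h0
  · rw [hgw ⟨⟨P, hS hPS⟩, hPS, hPS'⟩, Pi.single_eq_same, mul_one] at h0
    exact (hvS _).mpr hPS h0
  · intro k _ hk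
    by_cases hvk : v k = 0
    · rw [hvk, zero_mul]
    · by_cases hkS' : (k : Point F) ∈ S'
      · rw [hg.2 k hkS', mul_zero]
      · rw [hgw ⟨k, (hvS k).mp hvk, hkS'⟩,
          Pi.single_eq_of_ne (fun h => hk (congrArg Subtype.val h)), mul_zero]

/-! ### Weights, supports and minimum distance -/

theorem HasSupport.weight_eq {v : B → F} (h : HasSupport v S) : weight v = S.card := by
  classical
  have hS : S = (Finset.univ.filter fun k => v k ≠ 0).map (Function.Embedding.subtype _) := by
    ext P
    simp only [Finset.mem_map, Finset.mem_filter, Finset.mem_univ, true_and]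
    constructor
    · exact fun hP => ⟨⟨P, h.1 hP⟩, (h.2 _).mpr hP, rfl⟩
    · rintro ⟨k, hk, rfl⟩
      exact (h.2 k).mp hk
  rw [hS, Finset.card_map, weight, hammingNorm]

theorem exists_hasSupport (v : B → F) : ∃ S, HasSupport v S := by
  classical
  refine ⟨(Finset.univ.filter fun k => v k ≠ 0).map (Function.Embedding.subtype _), ?_, ?_⟩
  · intro P hP
    obtain ⟨k, -, rfl⟩ := Finset.mem_map.mp hP
    exact k.2
  · intro k
    simp [Finset.mem_map]

theorem minDist_eq_iInf_weight (C : Submodule F (B → F)) :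
    minDist C = ⨅ (v ∈ C) (_ : v ≠ 0), (weight v : ℕ∞) := by
  apply le_antisymm
  · refine le_iInf fun v => le_iInf fun hv => le_iInf fun h0 => ?_
    refine (iInf₂_le v hv).trans ((iInf₂_le 0 C.zero_mem).trans ((iInf_le _ h0).trans ?_))
    exact le_rfl
  · refine le_iInf fun v => le_iInf fun hv => le_iInf fun w => le_iInf fun hw => le_iInf fun h => ?_
    refine (iInf₂_le (v - w) (C.sub_mem hv hw)).trans ((iInf_le _ (sub_ne_zero.mpr h)).trans ?_)
    simp only [weight, hammingNorm, hammingDist, Pi.sub_apply]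
    exact_mod_cast Finset.card_le_card fun i hi => by simpa [sub_eq_zero] using hi

end Points

end

end PlaneCode

open PlaneCode

/-! ### The main theorem -/

theorem proposition3p1 {F : Type*} [Field F] (f : CoordRing F) (c d : ℕ)
    (hf : IsSmoothCurve f c) (hd : 0 < d) (hdc : d < c)
    (E : Subscheme F) (hE : E.IsZeroDimensional) (hEX : Ideal.span {f} ≤ E.ideal)
    (B : Finset (Point F))
    (p : B → Fin 3 → F) (hp : ∀ P : B, ∃ h : p P ≠ 0, Projectivization.mk F (p P) h = P)
    (hBX : ∀ P : B, MvPolynomial.eval (p P) f = 0)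
    (hBE : ∀ P : B, ¬ E.ideal ≤ pointIdeal (p P))
    (z : ℕ∞)
    (hz : z = ⨅ (S : Finset (Point F)) (_ : S ⊆ B)
      (_ : h1 (E.union (Subscheme.ofPoints S)) d > h1 E d),
      (S.card : ℕ∞)) :
    minDist (dualCode (evaluationCode f E d p)) = z ∧
    (∀ v ∈ dualCode (evaluationCode f E d p),
      (weight v : ℕ∞) = z ↔
        ∃ S : Finset (Point F), HasSupport v S ∧
          (S.card : ℕ∞) = z ∧
          h1 (E.union (Subscheme.ofPoints S)) d > h1 E d ∧
          ∀ S' : Finset (Point F), S' ⊂ S →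
            h1 (E.union (Subscheme.ofPoints S)) d >
              h1 (E.union (Subscheme.ofPoints S')) d) ∧
    (∀ S : Finset (Point F), S ⊆ B →
      ((∃ v ∈ dualCode (evaluationCode f E d p),
          (weight v : ℕ∞) = z ∧ HasSupport v S) ↔
        (S.card : ℕ∞) = z ∧
          h1 (E.union (Subscheme.ofPoints S)) d > h1 E d ∧
          ∀ S' : Finset (Point F), S' ⊂ S →
            h1 (E.union (Subscheme.ofPoints S)) d >
              h1 (E.union (Subscheme.ofPoints S')) d)) := by
  have hs := separatesPoints hp E.homogeneous hBE
  have hdual : ∀ v, v ∈ dualCode (evaluationCode f E d p) ↔ IsOrthogonal E d p v := by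
    intro v
    have hmem := mem_evaluationCode_iff (d := d) hf.1 hf.ne_zero E hEX p (fun k => (hp k).1) hBX
    constructor
    · exact fun hv g hg hgd => hv _ ((hmem _).mpr ⟨g, hg, hgd, fun _ => rfl⟩)
    · intro hv w hw
      obtain ⟨g, hg, hgd, hgw⟩ := (hmem w).mp hw
      obtain rfl : w = fun k => MvPolynomial.eval (p k) g := funext hgw
      exact hv g hg hgd
  have hbad : ∀ S : Finset (Point F), S ⊆ B →
      (h1 (E.union (Subscheme.ofPoints S)) d > h1 E d ↔
        ∃ v ∈ dualCode (evaluationCode f E d p), v ≠ 0 ∧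
          ∀ k : B, v k ≠ 0 → (k : Point F) ∈ S) := by
    intro S hS
    simp only [gt_iff_lt, h1_lt_h1_union_iff hp hs hE hS d, hdual]
  have hzle : ∀ S : Finset (Point F), S ⊆ B →
      h1 (E.union (Subscheme.ofPoints S)) d > h1 E d → z ≤ S.card := by
    intro S hS hb
    rw [hz]
    exact (iInf₂_le S hS).trans (iInf_le _ hb)
  have hsupp : ∀ v ∈ dualCode (evaluationCode f E d p), v ≠ 0 → ∀ S, HasSupport v S →
      h1 (E.union (Subscheme.ofPoints S)) d > h1 E d := fun v hv hv0 S hS =>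
    (hbad S hS.1).mpr ⟨v, hv, hv0, fun k => (hS.2 k).mp⟩
  have hsub : ∀ v : B → F, ∀ S T : Finset (Point F), HasSupport v T →
      (∀ k : B, v k ≠ 0 → (k : Point F) ∈ S) → T ⊆ S := fun v S T hT hS P hP =>
    hS ⟨P, hT.1 hP⟩ ((hT.2 _).mpr hP)
  -- This excludes the zero word from the words of weight `z`.
  have hpos : z ≠ 0 := by
    rw [hz, ← Order.one_le_iff_ne_zero]
    refine le_iInf fun S => le_iInf fun hS => le_iInf fun hb => ?_
    obtain ⟨v, -, hv0, hvS⟩ := (hbad S hS).mp hb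
    obtain ⟨k, hk⟩ := Function.ne_iff.mp hv0
    exact_mod_cast Finset.card_pos.mpr ⟨_, hvS k hk⟩
  have hmin : ∀ v ∈ dualCode (evaluationCode f E d p), (weight v : ℕ∞) = z →
      ∀ S, HasSupport v S → (S.card : ℕ∞) = z ∧
        h1 (E.union (Subscheme.ofPoints S)) d > h1 E d ∧
        ∀ S' : Finset (Point F), S' ⊂ S →
          h1 (E.union (Subscheme.ofPoints S)) d > h1 (E.union (Subscheme.ofPoints S')) d := by
    intro v hv hw S hS
    have hv0 : v ≠ 0 := by
      rintro rfl
      exact hpos (by rw [← hw]; simp [weight])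
    exact ⟨by rw [← hw, hS.weight_eq], hsupp v hv hv0 S hS, fun S' hS' =>
      h1_union_lt_h1_union hp hs hE hS.1 ((hdual v).mp hv) hS.2 hS'⟩
  refine ⟨?_, fun v hv => ⟨fun hw => ?_, ?_⟩, fun S hS => ⟨?_, ?_⟩⟩
  · rw [minDist_eq_iInf_weight]
    apply le_antisymm
    · rw [hz]
      refine le_iInf fun S => le_iInf fun hS => le_iInf fun hb => ?_
      obtain ⟨v, hv, hv0, hvS⟩ := (hbad S hS).mp hb
      obtain ⟨T, hT⟩ := exists_hasSupport v
      refine (iInf₂_le v hv).trans ((iInf_le _ hv0).trans ?_)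
      rw [hT.weight_eq]
      exact_mod_cast Finset.card_le_card (hsub v S T hT hvS)
    · refine le_iInf fun v => le_iInf fun hv => le_iInf fun hv0 => ?_
      obtain ⟨T, hT⟩ := exists_hasSupport v
      rw [hT.weight_eq]
      exact hzle T hT.1 (hsupp v hv hv0 T hT)
  · obtain ⟨S, hS⟩ := exists_hasSupport v
    exact ⟨S, hS, hmin v hv hw S hS⟩
  · rintro ⟨S, hS, hc, -⟩
    rw [hS.weight_eq, hc]
  · rintro ⟨v, hv, hw, hvS⟩
    exact hmin v hv hw S hvS
  · rintro ⟨hc, hb, -⟩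
    -- The support `T` of this word lies in `S` and raises h¹ itself, so minimality of `z` forces `T
    -- = S`.
    obtain ⟨v, hv, hv0, hvS⟩ := (hbad S hS).mp hb
    obtain ⟨T, hT⟩ := exists_hasSupport v
    have hTS := hsub v S T hT hvS
    have hle := hzle T hT.1 (hsupp v hv hv0 T hT)
    rw [← hc, Nat.cast_le] at hle
    obtain rfl := Finset.eq_of_subset_of_card_le hTS hle
    exact ⟨v, hv, by rw [hT.weight_eq, hc], hT⟩
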